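/- Let $k$ be a field and $m\ge 0$ an integer. An $m$-bonsai is a finite rooted tree whose edges are labelled by elements of $\{1,\dots,m\}$ so that the edges going down from any given vertex carry pairwise distinct labels; $\deg T$ is the number of vertices of $T$. A simple cut $c$ of $T$ is a (possibly empty) set of edges containing at most one edge of every path from the root to a vertex; $P_c(T)$ is the forest of branches cut off, $R_c(T)$ the remaining trunk (the component of the root). Let $\mathcal H_{b,m}=k[\delta_T : T \text{ an } m\text{-bonsai}]$, graded by $\deg\delta_T=\deg T$, with the coproduct (an algebra morphism), counit and antipode (algebra morphisms, $\mathcal H_{b,m}$ being commutative) given by $$\Delta\delta_T=\delta_T\otimes 1+\sum_{c}\Big(\prod_{T'\in P_c(T)}\delta_{T'}\Big)\otimes\delta_{R_c(T)},\qquad \epsilon(\delta_T)=0,\qquad S(\delta_T)=-\delta_T-\sum_{c\ne\emptyset}\Big(\prod_{T'\in P_c(T)}S(\delta_{T'})\Big)\delta_{R_c(T)},$$ where $c$ runs over the simple cuts of $T$. For a graded Hopf algebra $A=\bigoplus_n A_n$ with finite-dimensional components, $A^\vee=\bigoplus_n A_n^*$ denotes its graded dual, i.e. the functionals vanishing on all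 but finitely many $A_n$, with the transposed structure maps; in particular $\langle fg,a\rangle=\langle f\otimes g,\Delta a\rangle$ and $\langle\Delta f,a\otimes b\rangle=\langle f,ab\rangle$. Let $\mathcal L^1$ be the vector space with basis $\{Z_T\}$, $T$ running over the $m$-bonsais, mapped to the dual of $\mathcal H_{b,m}$ by $\langle Z_T,P\rangle=(\partial P/\partial\delta_T)(0)$. Let $*$ be the bilinear product $$Z_{T_1}*Z_{T_2}=\sum_T n(T_1,T_2;T)\,Z_T,$$ where $n(T_1,T_2;T)$ is the number of simple cuts of $T$ consisting of one edge, with cut branch $T_1$ and trunk $T_2$ (the sum is finite). Put $[x,y]=x*y-y*x$ and $A(x,y,z)=x*(y*z)-(x*y)*z$. Then: 1. $A(Z_{T_1},Z_{T_2},Z_{T_3})=\sum_T n(T_1,T_2,T_3;T)\,Z_T$, where $n(T_1,T_2,T_3;T)$ is the number of ordered pairs $(e_1,e_2)$ of distinct edges of $T$ such that $\{e_1,e_2\}$ is a simple cut, $e_1$ cuts off the branch $T_1$, $e_2$ cuts off the branch $T_2$, and the trunk is $T_3$. Moreover $*$ is (left) pre-Lie: $A(x,y,z)=A(y,x,z)$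 for all $x,y,z\in\mathcal L^1$. 2. (a) The bracket $[\ ,\ ]$ makes $\mathcal L^1$ a Lie algebra. 3. The map $\mathcal L^1\to(\mathcal H_{b,m})^*$ is injective, its image is exactly the space of primitive elements ($\Delta f=f\otimes 1+1\otimes f$) of the dual Hopf algebra $\mathcal H_{b,m}^\vee$, and it takes the bracket to the commutator of the product of $\mathcal H_{b,m}^\vee$. 4. (b) If $k$ has characteristic $0$, then $\mathcal H_{b,m}$ is the dual of the enveloping algebra of $\mathcal L^1$: grading $\mathcal U(\mathcal L^1)$ by $\deg Z_T=\deg T$, there are isomorphisms of graded Hopf algebras $$\Phi:\ \mathcal U(\mathcal L^1)\xrightarrow{\ \sim\ }\mathcal H_{b,m}^\vee,\qquad \Psi:\ \mathcal H_{b,m}\xrightarrow{\ \sim\ }\mathcal U(\mathcal L^1)^\vee,$$ (compatible with products, units, coproducts, counits, antipodes and gradings), with $\Phi(u)(P)=\Psi(P)(u)$ for all $u$ and $P$, and $\Phi(x)=\langle x,\cdot\,\rangle$ for $x\in\mathcal L^1$. -/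

import Mathlib

open scoped TensorProduct

namespace BonsaiHopf

/-! ### Bonsais

A vertex of a rooted tree with edge labels in `Fin m`, pairwise distinct below each vertex, is
determined by its address, the word of labels met on the path from the root to it.  So such a tree
is a finite prefix-closed set of words containing the empty word (the root); the edge above a
non-root vertex `v` is identified with `v`, and its label is the last letter of `v`. -/

/-- An `m`-bonsai: a finite rooted tree whose edges are labelled by `m` labels, without
duplication among the edges below a given vertex (so ramification numbers are at most `m`). -/
@[ext]
structure Bonsai (m : ℕ) where
  /-- the addresses of the vertices -/
  verts : Finset (List (Fin m))
  root_mem : [] ∈ verts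
  prefix_closed : ∀ v ∈ verts, ∀ w, w <+: v → w ∈ verts

namespace Bonsai

variable {m : ℕ}

instance : DecidableEq (Bonsai m) := fun _ _ => decidable_of_iff _ Bonsai.ext_iff.symm

/-- The degree of a bonsai is its number of vertices. -/
def deg (T : Bonsai m) : ℕ := T.verts.card

/-- The edges of `T`; an edge is named by its lower end. -/
def edges (T : Bonsai m) : Finset (List (Fin m)) := T.verts.erase []

theorem mem_edges {T : Bonsai m} {v : List (Fin m)} : v ∈ T.edges ↔ v ≠ [] ∧ v ∈ T.verts :=
  Finset.mem_erase

/-- The branch of `T` at the vertex `v`: its vertices are the words `w` with `v ++ w ∈ T`.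
(For `v ∉ T` this is the one-vertex bonsai.) -/
def branch (T : Bonsai m) (v : List (Fin m)) : Bonsai m where
  verts := insert [] ((T.verts.filter fun x => v <+: x).image (List.drop v.length))
  root_mem := Finset.mem_insert_self _ _
  prefix_closed := by
    intro x hx w hw
    rw [Finset.mem_insert] at hx ⊢
    rcases hx with rfl | hx
    · exact Or.inl (List.prefix_nil.mp hw)
    · right
      simp only [Finset.mem_image, Finset.mem_filter] at hx ⊢
      obtain ⟨y, ⟨hy, t, rfl⟩, rfl⟩ := hx
      rw [List.drop_left] at hw
      refine ⟨v ++ w, ⟨T.prefix_closed _ hy _ ?_, List.prefix_append _ _⟩, List.drop_left⟩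
      exact (List.prefix_append_right_inj v).mpr hw

theorem mem_branch {T : Bonsai m} {v : List (Fin m)} (hv : v ∈ T.verts) {w : List (Fin m)} :
    w ∈ (T.branch v).verts ↔ v ++ w ∈ T.verts := by
  simp only [branch, Finset.mem_insert, Finset.mem_image, Finset.mem_filter]
  constructor
  · rintro (rfl | ⟨y, ⟨hy, t, rfl⟩, rfl⟩)
    · simpa using hv
    · rwa [List.drop_left]
  · intro h
    exact Or.inr ⟨v ++ w, ⟨h, List.prefix_append _ _⟩, List.drop_left⟩

theorem deg_branch_lt {T : Bonsai m} {v : List (Fin m)} (hv : v ∈ T.edges) :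
    (T.branch v).deg < T.deg := by
  rw [mem_edges] at hv
  have h : ((T.branch v).verts.image (v ++ ·)) ⊆ T.verts.erase [] := by
    intro x hx
    obtain ⟨w, hw, rfl⟩ := Finset.mem_image.mp hx
    rw [mem_branch hv.2] at hw
    exact Finset.mem_erase.mpr ⟨by simp [hv.1], hw⟩
  have h1 := Finset.card_le_card h
  rw [Finset.card_image_of_injective _ (List.append_right_injective v)] at h1
  exact lt_of_le_of_lt h1 (Finset.card_erase_lt_of_mem T.root_mem)

/-- The trunk `R_c(T)`: the vertices of `T` that are not below an edge of `c`. -/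
def trunk (T : Bonsai m) (c : Finset (List (Fin m))) : Bonsai m where
  verts := T.verts.filter fun x => ∀ v ∈ c, v ≠ [] → ¬ v <+: x
  root_mem := Finset.mem_filter.mpr
    ⟨T.root_mem, fun _ _ hv h => hv (List.prefix_nil.mp h)⟩
  prefix_closed := by
    intro x hx w hw
    rw [Finset.mem_filter] at hx ⊢
    exact ⟨T.prefix_closed x hx.1 w hw, fun v hv h0 h => hx.2 v hv h0 (h.trans hw)⟩

/-- The simple cuts of `T`: the sets `c` of edges such that the path from the root to any vertex
`x` contains at most one edge of `c` (the edges on this path are the nonempty prefixes of `x`).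
The empty cut is allowed. -/
def simpleCuts (T : Bonsai m) : Finset (Finset (List (Fin m))) :=
  T.edges.powerset.filter fun c =>
    ∀ x ∈ T.verts, ∀ v ∈ c, ∀ w ∈ c, v <+: x → w <+: x → v = w

theorem mem_edges_of_mem_simpleCuts {T : Bonsai m} {c : Finset (List (Fin m))}
    (hc : c ∈ T.simpleCuts) {v : List (Fin m)} (hv : v ∈ c) : v ∈ T.edges :=
  Finset.mem_powerset.mp (Finset.mem_filter.mp hc).1 hv

/-- The forest `P_c(T)` of the branches that are cut off by `c`. -/
def pruned (T : Bonsai m) (c : Finset (List (Fin m))) : Multiset (Bonsai m) :=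
  c.val.map T.branch

/-- `n(T₁, T₂; T)`: the number of simple cuts of `T` with one edge, cut branch `T₁` and
trunk `T₂`. -/
def cutCount (T₁ T₂ T : Bonsai m) : ℕ :=
  (T.simpleCuts.filter fun c => c.card = 1 ∧ T.pruned c = {T₁} ∧ T.trunk c = T₂).card

/-- `n(T₁, T₂, T₃; T)`: the number of simple cuts of `T` with two edges, of which one (the first)
cuts off the branch `T₁` and the other (the second) cuts off the branch `T₂`, with trunk `T₃`;
that is, the number of ordered pairs of distinct edges that form such a cut. -/
def cutCount₂ (T₁ T₂ T₃ T : Bonsai m) : ℕ :=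
  ((T.edges ×ˢ T.edges).filter fun e => e.1 ≠ e.2 ∧ {e.1, e.2} ∈ T.simpleCuts ∧
    T.branch e.1 = T₁ ∧ T.branch e.2 = T₂ ∧ T.trunk {e.1, e.2} = T₃).card

theorem finite_cutCount (T₁ T₂ : Bonsai m) : {T | cutCount T₁ T₂ T ≠ 0}.Finite := by
  have key : ∀ T, cutCount T₁ T₂ T ≠ 0 → ∃ p ∈ T₂.verts ×ˢ (Finset.univ : Finset (Fin m)),
      T₂.verts ∪ T₁.verts.image ((p.1 ++ [p.2]) ++ ·) = T.verts := by
    intro T hT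
    obtain ⟨c, hc⟩ := Finset.card_ne_zero.mp hT
    obtain ⟨hs, h1, hp, ht⟩ := Finset.mem_filter.mp hc
    obtain ⟨v, rfl⟩ := Finset.card_eq_one.mp h1
    have hv := mem_edges_of_mem_simpleCuts hs (Finset.mem_singleton_self v)
    rw [mem_edges] at hv
    have hb : T.branch v = T₁ := by simpa [pruned] using hp
    have hv2 : v.dropLast ++ [v.getLast hv.1] = v := List.dropLast_append_getLast hv.1
    refine ⟨(v.dropLast, v.getLast hv.1), ?_, ?_⟩
    · rw [Finset.mem_product]
      refine ⟨?_, Finset.mem_univ _⟩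
      rw [← ht]
      refine Finset.mem_filter.mpr ⟨T.prefix_closed v hv.2 _ (List.dropLast_prefix v), ?_⟩
      intro w hw h0 h
      rw [Finset.mem_singleton] at hw
      subst hw
      have h2 := h.length_le
      rw [List.length_dropLast] at h2
      have h3 := List.length_pos_of_ne_nil h0
      omega
    · simp only [hv2]
      ext x
      simp only [Finset.mem_union, Finset.mem_image]
      constructor
      · rintro (h | ⟨w, hw, rfl⟩)
        · rw [← ht] at h
          exact (Finset.mem_filter.mp h).1
        · rw [← hb] at hw
          exact (mem_branch hv.2).mp hw
      · intro hx
        by_cases h : v <+: x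
        · obtain ⟨w, rfl⟩ := h
          refine Or.inr ⟨w, ?_, rfl⟩
          rw [← hb]
          exact (mem_branch hv.2).mpr hx
        · left
          rw [← ht]
          refine Finset.mem_filter.mpr ⟨hx, ?_⟩
          intro w hw _
          rw [Finset.mem_singleton] at hw
          rwa [hw]
  have hfin := Finset.finite_toSet ((T₂.verts ×ˢ (Finset.univ : Finset (Fin m))).image
    fun p => T₂.verts ∪ T₁.verts.image ((p.1 ++ [p.2]) ++ ·))
  refine Set.Finite.of_injOn (f := Bonsai.verts) (fun T hT => ?_)
    (fun _ _ _ _ h => Bonsai.ext h) hfin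
  exact Finset.mem_coe.mpr (Finset.mem_image.mpr (key T hT))

end Bonsai

/-! ### Graded duals of Hopf algebras -/

section GradedDual

/-- Coproduct, counit and antipode on an algebra. -/
structure HopfMaps (k A : Type*) [Field k] [Ring A] [Algebra k A] where
  comul : A →ₗ[k] A ⊗[k] A
  counit : A →ₗ[k] k
  antipode : A →ₗ[k] A

variable {k A B : Type*} [Field k] [Ring A] [Algebra k A] [Ring B] [Algebra k B]

/-- The graded dual of `A = ⨁ 𝒜 n`: the functionals that vanish on all but finitely many of the
homogeneous components. -/
def gradedDual (𝒜 : ℕ → Submodule k A) : Submodule k (Module.Dual k A) where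
  carrier := {f | ∃ N, ∀ n ≥ N, ∀ a ∈ 𝒜 n, f a = 0}
  zero_mem' := ⟨0, fun _ _ _ _ => rfl⟩
  add_mem' := by
    rintro f g ⟨N, hN⟩ ⟨M, hM⟩
    refine ⟨max N M, fun n hn a ha => ?_⟩
    rw [LinearMap.add_apply, hN n (le_trans (le_max_left _ _) hn) a ha,
      hM n (le_trans (le_max_right _ _) hn) a ha, add_zero]
  smul_mem' := by
    rintro c f ⟨N, hN⟩
    refine ⟨N, fun n hn a ha => ?_⟩
    rw [LinearMap.smul_apply, hN n hn a ha, smul_zero]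

/-- The product of functionals that is dual to the coproduct: `⟨f g, a⟩ = ⟨f ⊗ g, Δ a⟩`. -/
noncomputable def dualMul (H : HopfMaps k A) (f g : Module.Dual k A) : Module.Dual k A :=
  TensorProduct.dualDistrib k A A (f ⊗ₜ[k] g) ∘ₗ H.comul

/-- The functional `f` has the coproduct `t`, for the coproduct of the dual, which is the transpose
of the product: `⟨t, a ⊗ b⟩ = ⟨f, a b⟩`. -/
def HasDualComul (f : Module.Dual k A) (t : Module.Dual k A ⊗[k] Module.Dual k A) : Prop :=
  TensorProduct.dualDistrib k A A t = f ∘ₗ LinearMap.mul' k A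

/-- `f` is primitive in the dual: `Δ f = f ⊗ 1 + 1 ⊗ f`, where the unit of the dual is the
counit of `A`. -/
def IsDualPrimitive (H : HopfMaps k A) (f : Module.Dual k A) : Prop :=
  HasDualComul f (f ⊗ₜ[k] H.counit + H.counit ⊗ₜ[k] f)

/-- `Φ` is an isomorphism of graded Hopf algebras from `B` to the graded dual of `A`. -/
structure IsGradedHopfIso (ℬ : ℕ → Submodule k B) (𝒜 : ℕ → Submodule k A)
    (HB : HopfMaps k B) (HA : HopfMaps k A) (Φ : B ≃ₗ[k] gradedDual 𝒜) : Prop where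
  map_one : (Φ 1 : Module.Dual k A) = HA.counit
  map_mul : ∀ x y, (Φ (x * y) : Module.Dual k A) = dualMul HA (Φ x) (Φ y)
  map_comul : ∀ x, HasDualComul (Φ x : Module.Dual k A)
    (TensorProduct.map ((gradedDual 𝒜).subtype ∘ₗ Φ.toLinearMap)
      ((gradedDual 𝒜).subtype ∘ₗ Φ.toLinearMap) (HB.comul x))
  map_counit : ∀ x, (Φ x : Module.Dual k A) 1 = HB.counit x
  map_antipode : ∀ x, (Φ (HB.antipode x) : Module.Dual k A) =
    (Φ x : Module.Dual k A) ∘ₗ HA.antipode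
  map_grading : ∀ n x, x ∈ ℬ n ↔ ∀ j, j ≠ n → ∀ a ∈ 𝒜 j, (Φ x : Module.Dual k A) a = 0

end GradedDual

/-! ### The bonsai Hopf algebra -/

section Hopf

variable (k : Type*) [Field k] (m : ℕ)

/-- The `m`-bonsai algebra `H_{b,m}`: the polynomial algebra on the `m`-bonsais, whose monomials
are the forests. The generator `δ_T` is `MvPolynomial.X T`. -/
abbrev BonsaiAlg := MvPolynomial (Bonsai m) k

variable {m} in
/-- The monomial `δ_F` of a forest `F`. -/
noncomputable def forest (F : Multiset (Bonsai m)) : BonsaiAlg k m :=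
  (F.map MvPolynomial.X).prod

/-- The coproduct: the algebra morphism with `Δ δ_T = δ_T ⊗ 1 + ∑_c δ_{P_c(T)} ⊗ δ_{R_c(T)}`,
the sum being over all simple cuts of `T`, the empty one included. -/
noncomputable def comul : BonsaiAlg k m →ₐ[k] BonsaiAlg k m ⊗[k] BonsaiAlg k m :=
  MvPolynomial.aeval fun T =>
    MvPolynomial.X T ⊗ₜ[k] 1 +
      ∑ c ∈ T.simpleCuts, forest k (T.pruned c) ⊗ₜ[k] MvPolynomial.X (T.trunk c)

/-- The counit: it sends `1` to `1` and every nonempty forest to `0`. -/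
noncomputable def counit : BonsaiAlg k m →ₐ[k] k := MvPolynomial.aeval fun _ => 0

variable {m} in
/-- The antipode on generators:
`S(δ_T) = -δ_T - ∑_{c ≠ ∅} (∏_{T' ∈ P_c(T)} S(δ_{T'})) δ_{R_c(T)}`. -/
noncomputable def antipodeGen (T : Bonsai m) : BonsaiAlg k m :=
  -MvPolynomial.X T - ∑ c ∈ (T.simpleCuts.erase ∅).attach,
    (∏ v ∈ c.1.attach, antipodeGen (T.branch v.1)) * MvPolynomial.X (T.trunk c.1)
termination_by T.deg
decreasing_by
  exact Bonsai.deg_branch_lt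
    (Bonsai.mem_edges_of_mem_simpleCuts (Finset.mem_of_mem_erase c.2) v.2)

/-- The antipode. -/
noncomputable def antipode : BonsaiAlg k m →ₐ[k] BonsaiAlg k m :=
  MvPolynomial.aeval (antipodeGen k)

/-- The Hopf algebra structure of `H_{b,m}`. -/
noncomputable def bonsaiHopf : HopfMaps k (BonsaiAlg k m) where
  comul := (comul k m).toLinearMap
  counit := (counit k m).toLinearMap
  antipode := (antipode k m).toLinearMap

/-- The grading of `H_{b,m}` by the number of vertices of forests. -/
noncomputable def bonsaiGrading (n : ℕ) : Submodule k (BonsaiAlg k m) :=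
  MvPolynomial.weightedHomogeneousSubmodule k Bonsai.deg n

/-! ### The space `L¹` -/

/-- The space `L¹`, with basis `Z_T = Finsupp.single T 1`. -/
abbrev L1 := Bonsai m →₀ k

/-- The embedding of `L¹` into the dual of `H_{b,m}`: `⟨Z_T, P⟩ = (∂P/∂δ_T)(0)`. -/
noncomputable def zMap : L1 k m →ₗ[k] Module.Dual k (BonsaiAlg k m) :=
  Finsupp.linearCombination k fun T =>
    (counit k m).toLinearMap ∘ₗ (MvPolynomial.pderiv T).toLinearMap

/-- The product of `L¹`: the bilinear map with `Z_{T₁} * Z_{T₂} = ∑_T n(T₁, T₂; T) Z_T`. -/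
noncomputable def graft : L1 k m →ₗ[k] L1 k m →ₗ[k] L1 k m :=
  Finsupp.linearCombination k fun T₁ => Finsupp.linearCombination k fun T₂ =>
    Finsupp.ofSupportFinite (fun T => (Bonsai.cutCount T₁ T₂ T : k))
      ((Bonsai.finite_cutCount T₁ T₂).subset fun T hT h0 => hT (by
        change (Bonsai.cutCount T₁ T₂ T : k) = 0
        rw [h0, Nat.cast_zero]))

/-- The associator `A(x, y, z) = x * (y * z) - (x * y) * z`. -/
noncomputable def assoc (x y z : L1 k m) : L1 k m :=
  graft k m x (graft k m y z) - graft k m (graft k m x y) z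

/-- The bracket `[x, y] = x * y - y * x`. -/
noncomputable def bracket : L1 k m →ₗ[k] L1 k m →ₗ[k] L1 k m :=
  LinearMap.mk₂ k (fun x y => graft k m x y - graft k m y x)
    (fun x y z => by rw [map_add, map_add, LinearMap.add_apply]; abel)
    (fun c x y => by rw [map_smul, map_smul, LinearMap.smul_apply, smul_sub])
    (fun x y z => by rw [map_add, map_add, LinearMap.add_apply]; abel)
    (fun c x y => by rw [map_smul, map_smul, LinearMap.smul_apply, smul_sub])

end Hopf

/-! ### Enveloping algebras -/

section Lie

variable {k L : Type*} [Field k] [AddCommGroup L] [Module k L]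

/-- The bilinear map `b` is a Lie bracket. -/
structure IsLieBracket (b : L →ₗ[k] L →ₗ[k] L) : Prop where
  self : ∀ x, b x x = 0
  jacobi : ∀ x y z, b (b x y) z + b (b y z) x + b (b z x) y = 0

theorem IsLieBracket.skew {b : L →ₗ[k] L →ₗ[k] L} (h : IsLieBracket b) (x y : L) :
    b x y = -b y x := by
  have h1 := h.self (x + y)
  simp only [map_add, LinearMap.add_apply, h.self, zero_add, add_zero] at h1
  exact eq_neg_of_add_eq_zero_right h1

/-- The Lie algebra with underlying vector space `L` and bracket `b`. -/
def LieOf (b : L →ₗ[k] L →ₗ[k] L) (_ : IsLieBracket b) : Type _ := L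

variable {b : L →ₗ[k] L →ₗ[k] L} (h : IsLieBracket b)

instance : AddCommGroup (LieOf b h) := inferInstanceAs (AddCommGroup L)

instance : Module k (LieOf b h) := inferInstanceAs (Module k L)

instance : LieRing (LieOf b h) :=
  { (inferInstance : AddCommGroup (LieOf b h)) with
    bracket := fun x y => (b x y : L)
    add_lie := fun x y z => LinearMap.map_add₂ b x y z
    lie_add := fun x y z => map_add (b x) y z
    lie_self := h.self
    leibniz_lie := fun x y z => by
      have h1 := h.jacobi x y z
      rw [h.skew (b y z) x, h.skew (b z x) y, h.skew z x, map_neg, neg_neg] at h1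
      change b x (b y z) = b (b x y) z + b y (b x z)
      rw [← sub_eq_zero, ← neg_eq_zero, ← h1]
      abel }

instance : LieAlgebra k (LieOf b h) :=
  { (inferInstance : Module k (LieOf b h)) with
    lie_smul := fun t x y => map_smul (b x) t y }

/-- The identity map from `L` to the Lie algebra `LieOf b h`. -/
def toLieOf : L ≃ₗ[k] LieOf b h := LinearEquiv.refl k L

variable (k) (𝔤 : Type*) [LieRing 𝔤] [LieAlgebra k 𝔤]

attribute [local instance] LieRing.ofAssociativeRing

/-- The coproduct of `U(𝔤)`: the algebra morphism with `Δ x = x ⊗ 1 + 1 ⊗ x` for `x ∈ 𝔤`. -/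
noncomputable def envComul : UniversalEnvelopingAlgebra k 𝔤 →ₐ[k]
    UniversalEnvelopingAlgebra k 𝔤 ⊗[k] UniversalEnvelopingAlgebra k 𝔤 :=
  UniversalEnvelopingAlgebra.lift k
    { toFun := fun x => UniversalEnvelopingAlgebra.ι k x ⊗ₜ[k] 1 +
        1 ⊗ₜ[k] UniversalEnvelopingAlgebra.ι k x
      map_add' := fun x y => by
        rw [map_add, TensorProduct.add_tmul, TensorProduct.tmul_add]
        abel
      map_smul' := fun t x => by
        rw [map_smul, RingHom.id_apply, smul_add, TensorProduct.tmul_smul,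
          ← TensorProduct.smul_tmul']
      map_lie' := fun {x y} => by
        rw [LieHom.map_lie, LieRing.of_associative_ring_bracket,
          LieRing.of_associative_ring_bracket]
        simp only [TensorProduct.sub_tmul, TensorProduct.tmul_sub, add_mul, mul_add,
          Algebra.TensorProduct.tmul_mul_tmul, mul_one, one_mul]
        abel }

/-- The counit of `U(𝔤)`: the algebra morphism that vanishes on `𝔤`. -/
noncomputable def envCounit : UniversalEnvelopingAlgebra k 𝔤 →ₐ[k] k :=
  UniversalEnvelopingAlgebra.lift k 0

/-- The antipode of `U(𝔤)` as a morphism to the opposite algebra: `S x = -x` for `x ∈ 𝔤`. -/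
noncomputable def envAntipodeOp : UniversalEnvelopingAlgebra k 𝔤 →ₐ[k]
    (UniversalEnvelopingAlgebra k 𝔤)ᵐᵒᵖ :=
  UniversalEnvelopingAlgebra.lift k
    { toFun := fun x => MulOpposite.op (-UniversalEnvelopingAlgebra.ι k x)
      map_add' := fun x y => by rw [map_add, neg_add, MulOpposite.op_add]
      map_smul' := fun t x => by rw [map_smul, RingHom.id_apply, ← smul_neg, MulOpposite.op_smul]
      map_lie' := fun {x y} => by
        rw [LieHom.map_lie, LieRing.of_associative_ring_bracket,
          LieRing.of_associative_ring_bracket, ← MulOpposite.op_mul, ← MulOpposite.op_mul,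
          ← MulOpposite.op_sub]
        congr 1
        noncomm_ring }

/-- The Hopf algebra structure of `U(𝔤)`. -/
noncomputable def envHopf : HopfMaps k (UniversalEnvelopingAlgebra k 𝔤) where
  comul := (envComul k 𝔤).toLinearMap
  counit := (envCounit k 𝔤).toLinearMap
  antipode := (MulOpposite.opLinearEquiv k).symm.toLinearMap ∘ₗ (envAntipodeOp k 𝔤).toLinearMap

end Lie

section Env

variable (k : Type*) [Field k] (m : ℕ) (h : IsLieBracket (bracket k m))

attribute [local instance] LieRing.ofAssociativeRing

/-- The enveloping algebra `U(L¹)`. -/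
abbrev EnvL1 := UniversalEnvelopingAlgebra k (LieOf (bracket k m) h)

/-- The inclusion of `L¹` into `U(L¹)`. -/
noncomputable def envIncl : L1 k m →ₗ[k] EnvL1 k m h :=
  (UniversalEnvelopingAlgebra.ι k : LieOf (bracket k m) h →ₗ⁅k⁆ EnvL1 k m h).toLinearMap ∘ₗ
    (toLieOf h).toLinearMap

/-- The grading of `U(L¹)` in which `Z_T` has the degree of `T`: the component of degree `n` is
spanned by the products `Z_{T₁} ⋯ Z_{Tᵣ}` with `deg T₁ + ⋯ + deg Tᵣ = n`. -/
noncomputable def envGrading (n : ℕ) : Submodule k (EnvL1 k m h) :=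
  Submodule.span k {u | ∃ l : List (Bonsai m), (l.map Bonsai.deg).sum = n ∧
    u = (l.map fun T => envIncl k m h (Finsupp.single T 1)).prod}

end Env

end BonsaiHopf

/-!
Write `H` for the bonsai algebra. The proof rests on one sum, `edgeSum x z T`, which runs over the
edges `e` of `T` and evaluates `x` at the branch and `z` at the trunk that `e` separates. The
product of `L¹` is `edgeSum`, and the transpose of left multiplication by `x ∈ L¹` in the dual of `H` is the
derivation `cutDer x` of `H` with `δ_T ↦ x(T) + edgeSum x δ T`.

* Cutting an edge `e` and then an edge `f` of the trunk, `f` is either above `e` or on no common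
  path with `e`. Thus (`edgeSum_edgeSum`) the associator is a sum over the pairs of edges on no common
  path, which is symmetric in its first two arguments. The same identity, with values in `H`, says
  that `cutDer` represents the Lie algebra `L¹` on `H` from the right (`cutDer_bracket`). Hence
  `U(L¹)` acts on `H`, and followed by the counit this action is a pairing
  `⟨u, P⟩` of `U(L¹)` with `H`, `envPairing`.
* Cutting an edge and then a simple cut of the trunk (`sum_edges_sum_simpleCuts`) gives
  `Δ ∘ cutDer x = (cutDer x ⊗ 1) ∘ Δ` (`comul_cutDer`). This is all of the coassociativity of `H`
  that is needed: it yields `⟨u v, P⟩ = ⟨u ⊗ v, Δ P⟩`, and `⟨u, P Q⟩ = ⟨Δ u, P ⊗ Q⟩` holds because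
  the `cutDer x` are derivations.
* The pairing is perfect in each degree in characteristic zero. A product of `r` elements of `L¹`
  kills the forests of more than `r` trees, and pairs with a forest of `r` trees as a product of `r`
  partial derivatives does (`envPairing_zProd_cons_eq_pderiv`). So the matrix of the pairing between
  products `Z_{T₁} ⋯ Z_{Tᵣ}`, one for each forest, and forests is triangular with nonzero diagonal
  entries. These products span `U(L¹)`; that they are linearly independent, the hard half of the
  Poincaré-Birkhoff-Witt theorem, is a consequence of triangularity.
* The transpose of the antipode of `H` is a left inverse of the identity of `U(L¹)` for the
  convolution product, and the antipode of `U(L¹)` is a right inverse, so they agree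
  (`antipodeTranspose_eq`).
-/

namespace BonsaiHopf

attribute [local instance] LieRing.ofAssociativeRing

/-! ### Branches and trunks -/

namespace Bonsai

variable {m : ℕ} {T : Bonsai m}

theorem mem_trunk_singleton {e x : List (Fin m)} (he : e ≠ []) :
    x ∈ (T.trunk {e}).verts ↔ x ∈ T.verts ∧ ¬ e <+: x := by
  simp [trunk, he]

theorem mem_trunk {c : Finset (List (Fin m))} {x : List (Fin m)} :
    x ∈ (T.trunk c).verts ↔ x ∈ T.verts ∧ ∀ v ∈ c, v ≠ [] → ¬ v <+: x := by
  simp [trunk]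

theorem trunk_trunk (c d : Finset (List (Fin m))) : (T.trunk c).trunk d = T.trunk (c ∪ d) := by
  ext x
  simp only [mem_trunk, Finset.mem_union]
  grind

theorem trunk_empty : T.trunk ∅ = T := by
  ext x
  simp [mem_trunk]

/-- Cutting below `f` does not change the trunk if `f` is cut as well. -/
theorem trunk_insert_of_prefix {c : Finset (List (Fin m))} {f e : List (Fin m)} (hf : f ∈ c)
    (hf0 : f ≠ []) (h : f <+: e) : T.trunk (insert e c) = T.trunk c := by
  ext x
  simp only [mem_trunk, Finset.mem_insert]
  refine ⟨fun hx => ⟨hx.1, fun v hv => hx.2 v (Or.inr hv)⟩, fun hx => ⟨hx.1, ?_⟩⟩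
  rintro v (rfl | hv) h0 hvx
  · exact hx.2 f hf hf0 (h.trans hvx)
  · exact hx.2 v hv h0 hvx

theorem mem_edges_trunk_singleton {e f : List (Fin m)} (he : e ≠ []) :
    f ∈ (T.trunk {e}).edges ↔ f ∈ T.edges ∧ ¬ e <+: f := by
  rw [mem_edges, mem_edges, mem_trunk_singleton he, and_assoc]

/-- A set of edges is a simple cut if and only if it is an antichain for the prefix order. -/
theorem mem_simpleCuts {c : Finset (List (Fin m))} :
    c ∈ T.simpleCuts ↔ (∀ v ∈ c, v ∈ T.edges) ∧ ∀ v ∈ c, ∀ w ∈ c, v <+: w → v = w := by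
  simp only [simpleCuts, Finset.mem_filter, Finset.mem_powerset, Finset.subset_iff]
  refine and_congr_right fun hc => ⟨fun h v hv w hw hvw => ?_, fun h x _ v hv w hw hvx hwx => ?_⟩
  · exact h w (mem_edges.mp (hc hw)).2 v hv w hw hvw (List.prefix_refl w)
  · rcases List.prefix_or_prefix_of_prefix hvx hwx with h1 | h1
    · exact h v hv w hw h1
    · exact (h w hw v hv h1).symm

theorem empty_mem_simpleCuts : ∅ ∈ T.simpleCuts := by
  simp [mem_simpleCuts]

theorem singleton_mem_simpleCuts {v : List (Fin m)} : {v} ∈ T.simpleCuts ↔ v ∈ T.edges := by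
  simp [mem_simpleCuts]

theorem branch_branch {v w : List (Fin m)} (hv : v ++ w ∈ T.verts) :
    (T.branch v).branch w = T.branch (v ++ w) := by
  have h1 : v ∈ T.verts := T.prefix_closed _ hv _ (List.prefix_append v w)
  ext x
  rw [mem_branch hv, mem_branch ((mem_branch h1).mpr hv), mem_branch h1, List.append_assoc]

theorem branch_trunk_of_not_prefix {e f : List (Fin m)} (hf : f ∈ T.verts) (he : e ≠ [])
    (h1 : ¬ e <+: f) (h2 : ¬ f <+: e) : (T.trunk {e}).branch f = T.branch f := by
  ext x
  rw [mem_branch ((mem_trunk_singleton he).mpr ⟨hf, h1⟩), mem_branch hf, mem_trunk_singleton he]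
  refine and_iff_left fun h => ?_
  exact (List.prefix_or_prefix_of_prefix h (List.prefix_append f x)).elim h1 h2

theorem branch_trunk_append {f w : List (Fin m)} (hf : f ∈ T.verts) (hw : w ≠ []) :
    (T.trunk {f ++ w}).branch f = (T.branch f).trunk {w} := by
  have h0 : f ++ w ≠ [] := by simp [hw]
  have h1 : ¬ f ++ w <+: f := fun h => hw (by simpa using h.length_le)
  ext x
  rw [mem_branch ((mem_trunk_singleton h0).mpr ⟨hf, h1⟩), mem_trunk_singleton h0,
    mem_trunk_singleton hw, mem_branch hf, List.prefix_append_right_inj]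

/-- The edges of `T` strictly below `f` are the edges of the branch at `f`. -/
theorem filter_edges_prefix {f : List (Fin m)} (hf : f ∈ T.verts) :
    (T.edges.filter fun e => f <+: e ∧ ¬ e <+: f) = (T.branch f).edges.image (f ++ ·) := by
  ext e
  simp only [Finset.mem_filter, Finset.mem_image, mem_edges]
  constructor
  · rintro ⟨⟨he, heT⟩, ⟨w, rfl⟩, h⟩
    refine ⟨w, ⟨?_, (mem_branch hf).mpr heT⟩, rfl⟩
    rintro rfl
    simp at h
  · rintro ⟨w, ⟨hw, hwT⟩, rfl⟩
    exact ⟨⟨by simp [hw], (mem_branch hf).mp hwT⟩, List.prefix_append _ _,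
      fun h => hw (by simpa using h.length_le)⟩

theorem sum_edges_prefix {M : Type*} [AddCommMonoid M] {f : List (Fin m)} (hf : f ∈ T.verts)
    (g : List (Fin m) → M) :
    ∑ e ∈ T.edges with f <+: e ∧ ¬ e <+: f, g e = ∑ e ∈ (T.branch f).edges, g (f ++ e) := by
  rw [filter_edges_prefix hf, Finset.sum_image fun _ _ _ _ h => List.append_cancel_left h]

theorem deg_trunk_add_deg_branch {e : List (Fin m)} (he : e ∈ T.edges) :
    (T.branch e).deg + (T.trunk {e}).deg = T.deg := by
  have he' := mem_edges.mp he
  have h1 : (T.verts.filter fun x => e <+: x) = (T.branch e).verts.image (e ++ ·) := by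
    ext x
    simp only [Finset.mem_filter, Finset.mem_image]
    constructor
    · rintro ⟨hx, w, rfl⟩
      exact ⟨w, (mem_branch he'.2).mpr hx, rfl⟩
    · rintro ⟨w, hw, rfl⟩
      exact ⟨(mem_branch he'.2).mp hw, List.prefix_append _ _⟩
  have h2 : (T.trunk {e}).verts = T.verts.filter fun x => ¬ e <+: x := by
    ext x
    rw [mem_trunk_singleton he'.1, Finset.mem_filter]
  rw [deg, deg, deg, h2, ← Finset.card_filter_add_card_filter_not (s := T.verts) (e <+: ·), h1,
    Finset.card_image_of_injective _ (List.append_right_injective e)]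

theorem deg_pos (T : Bonsai m) : 0 < T.deg := Finset.card_pos.mpr ⟨_, T.root_mem⟩

theorem length_lt_deg {v : List (Fin m)} (hv : v ∈ T.verts) : v.length < T.deg := by
  have h : (Finset.range (v.length + 1)).image (fun i => v.take i) ⊆ T.verts := by
    intro w hw
    obtain ⟨i, -, rfl⟩ := Finset.mem_image.mp hw
    exact T.prefix_closed v hv _ (List.take_prefix i v)
  have h1 := Finset.card_le_card h
  rw [Finset.card_image_of_injOn, Finset.card_range] at h1
  · exact h1
  · intro i hi j hj hij
    have := congrArg List.length hij
    simp only [Finset.coe_range, Set.mem_Iio] at hi hj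
    simp only [List.length_take] at this
    omega

variable (m) in
/-- A vertex of a bonsai of degree at most `n` is a word of fewer than `n` letters. -/
theorem finite_deg_le (n : ℕ) : {T : Bonsai m | T.deg ≤ n}.Finite := by
  have hw : {v : List (Fin m) | v.length < n}.Finite := List.finite_length_lt _ _
  refine Set.Finite.of_injOn (f := fun T : Bonsai m => T.verts) (t := ↑hw.toFinset.powerset)
    (fun T hT => ?_) (fun _ _ _ _ h => Bonsai.ext h) (Finset.finite_toSet _)
  rw [Finset.mem_coe, Finset.mem_powerset]
  intro v hv
  simpa using (length_lt_deg hv).trans_le hT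

end Bonsai

/-! ### Cutting one edge, then another -/

section GraftSum

open Bonsai

variable {m : ℕ} {k : Type*} [CommSemiring k] {M : Type*} [AddCommMonoid M] [Module k M]

/-- The sum over the edges `e` of `T` of the values of `x` at the branch and of `z` at the trunk
that `e` separates.  For `M = k` it is the product of `L¹`, for `x` and `z` viewed as functions. -/
def edgeSum (x : Bonsai m → k) (z : Bonsai m → M) (T : Bonsai m) : M :=
  ∑ e ∈ T.edges, x (T.branch e) • z (T.trunk {e})

/-- The sum over the ordered pairs of edges of `T` that lie on no common path from the root. -/
def edgePairSum (x y : Bonsai m → k) (z : Bonsai m → M) (T : Bonsai m) : M :=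
  ∑ e ∈ T.edges, ∑ f ∈ T.edges with ¬ e <+: f ∧ ¬ f <+: e,
    (x (T.branch e) * y (T.branch f)) • z (T.trunk {e, f})

/-- An edge `f` of the trunk that is left after cutting `e` is either above `e` or on no common
path with `e`. -/
theorem edgeSum_edgeSum (x y : Bonsai m → k) (z : Bonsai m → M) (T : Bonsai m) :
    edgeSum x (edgeSum y z) T = edgePairSum x y z T + edgeSum (edgeSum x y) z T := by
  have key : ∀ e ∈ T.edges, x (T.branch e) • edgeSum y z (T.trunk {e}) =
      (∑ f ∈ T.edges with ¬ e <+: f ∧ ¬ f <+: e,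
        (x (T.branch e) * y (T.branch f)) • z (T.trunk {e, f})) +
      ∑ f ∈ T.edges with f <+: e ∧ ¬ e <+: f,
        (x (T.branch e) * y ((T.trunk {e}).branch f)) • z (T.trunk {f}) := by
    intro e he
    have he0 := (mem_edges.mp he).1
    have h1 : (T.trunk {e}).edges = T.edges.filter fun f => ¬ e <+: f := by
      ext f
      rw [mem_edges_trunk_singleton he0, Finset.mem_filter]
    rw [edgeSum, Finset.smul_sum, h1, add_comm, ← Finset.sum_filter_add_sum_filter_not _ (· <+: e),
      Finset.filter_filter, Finset.filter_filter]
    congr 1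
    · refine Finset.sum_congr (Finset.filter_congr fun f _ => and_comm) fun f hf => ?_
      obtain ⟨hf, hfe, -⟩ := Finset.mem_filter.mp hf
      rw [smul_smul, trunk_trunk, Finset.singleton_union,
        trunk_insert_of_prefix (Finset.mem_singleton_self f) (mem_edges.mp hf).1 hfe]
    · refine Finset.sum_congr rfl fun f hf => ?_
      obtain ⟨hf, hef, hfe⟩ := Finset.mem_filter.mp hf
      rw [smul_smul, trunk_trunk, Finset.singleton_union,
        branch_trunk_of_not_prefix (mem_edges.mp hf).2 he0 hef hfe]
  rw [edgeSum, Finset.sum_congr rfl key, Finset.sum_add_distrib, edgePairSum]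
  congr 1
  -- If `f` is above `e`, sum over `f` first: then `e` runs over the edges of the branch at `f`.
  rw [Finset.sum_comm' (s' := fun f => T.edges.filter fun e => f <+: e ∧ ¬ e <+: f)
    (t' := T.edges)]
  · refine Finset.sum_congr rfl fun f hf => ?_
    have hfT := (mem_edges.mp hf).2
    rw [sum_edges_prefix hfT, ← Finset.sum_smul, edgeSum]
    congr 1
    refine Finset.sum_congr rfl fun w hw => ?_
    rw [mem_edges, mem_branch hfT] at hw
    rw [branch_branch hw.2, branch_trunk_append hfT hw.1, smul_eq_mul]
  · intro e f
    simp only [Finset.mem_filter]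
    tauto

theorem edgePairSum_comm (x y : Bonsai m → k) (z : Bonsai m → M) (T : Bonsai m) :
    edgePairSum x y z T = edgePairSum y x z T := by
  rw [edgePairSum, Finset.sum_comm' (s' := fun f => T.edges.filter fun e => ¬ f <+: e ∧ ¬ e <+: f)
    (t' := T.edges)]
  · refine Finset.sum_congr rfl fun f _ => Finset.sum_congr rfl fun e _ => ?_
    rw [mul_comm, Finset.pair_comm]
  · intro e f
    simp only [Finset.mem_filter]
    tauto

end GraftSum

/-! ### Cutting one edge, then a simple cut of the trunk -/

section CutSum

open Bonsai

variable {m : ℕ}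

theorem insert_mem_simpleCuts {T : Bonsai m} {e : List (Fin m)} (he : e ∈ T.edges)
    {c : Finset (List (Fin m))} (hc : c ∈ (T.trunk {e}).simpleCuts) (h : ∀ w ∈ c, ¬ w <+: e) :
    insert e c ∈ T.simpleCuts := by
  have he0 := (mem_edges.mp he).1
  rw [mem_simpleCuts] at hc ⊢
  simp only [mem_edges_trunk_singleton he0] at hc
  simp only [Finset.mem_insert]
  grind

theorem erase_mem_simpleCuts {T : Bonsai m} {c : Finset (List (Fin m))} (hc : c ∈ T.simpleCuts)
    {e : List (Fin m)} (he : e ∈ c) :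
    c.erase e ∈ (T.trunk {e}).simpleCuts ∧ ∀ w ∈ c.erase e, ¬ w <+: e := by
  rw [mem_simpleCuts] at hc ⊢
  have he0 := (mem_edges.mp (hc.1 e he)).1
  simp only [mem_edges_trunk_singleton he0, Finset.mem_erase]
  grind

/-- A cut of `T.trunk {e}` through an edge `w` above `e` is the same as a cut of `T` through `w`. -/
theorem mem_simpleCuts_trunk_iff {T : Bonsai m} {e w : List (Fin m)} (he : e ∈ T.edges)
    {c : Finset (List (Fin m))} (hw : w ∈ c) (h : w <+: e) :
    c ∈ (T.trunk {e}).simpleCuts ↔ c ∈ T.simpleCuts ∧ ¬ e <+: w := by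
  have he0 := (mem_edges.mp he).1
  rw [mem_simpleCuts, mem_simpleCuts]
  simp only [mem_edges_trunk_singleton he0]
  refine ⟨fun hc => ⟨⟨fun v hv => (hc.1 v hv).1, hc.2⟩, (hc.1 w hw).2⟩, fun hc => ⟨fun v hv =>
    ⟨hc.1.1 v hv, fun hev => ?_⟩, hc.1.2⟩⟩
  have := hc.1.2 w hw v hv (h.trans hev)
  exact hc.2 (this ▸ hev)

variable {k : Type*} [CommSemiring k] {A : Type*} [CommSemiring A] [Algebra k A]
  {N : Type*} [AddCommMonoid N] [Module A N] [Module k N] [IsScalarTower k A N]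

/-- Cutting an edge `e` of `T` and then a simple cut of the trunk amounts to taking a simple cut of
`T` and cutting one of its branches at an edge `e`, or discarding that branch (if `e` belongs to
the cut). -/
theorem sum_edges_sum_simpleCuts (x : Bonsai m → k) (g : Bonsai m → A) (r : Bonsai m → N)
    (T : Bonsai m) :
    edgeSum x (fun T => ∑ c ∈ T.simpleCuts, (∏ v ∈ c, g (T.branch v)) • r (T.trunk c)) T =
      ∑ c ∈ T.simpleCuts, ∑ v ∈ c,
        ((x (T.branch v) • 1 + edgeSum x g (T.branch v)) * ∏ w ∈ c.erase v, g (T.branch w)) •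
          r (T.trunk c) := by
  -- A cut of the trunk either contains no edge above `e`, or exactly one. The latter cuts are
  -- indexed by the pairs of a cut and an edge of it above `e`.
  have hsplit : ∀ e ∈ T.edges, x (T.branch e) • ∑ c ∈ (T.trunk {e}).simpleCuts,
        (∏ v ∈ c, g ((T.trunk {e}).branch v)) • r ((T.trunk {e}).trunk c) =
      (∑ c ∈ (T.trunk {e}).simpleCuts with ∀ w ∈ c, ¬ w <+: e,
        (x (T.branch e) • ∏ w ∈ c, g (T.branch w)) • r (T.trunk (insert e c))) +
      ∑ p ∈ (T.trunk {e}).simpleCuts.sigma fun c => c.filter (· <+: e),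
        (x (T.branch e) • (g ((T.trunk {e}).branch p.2) * ∏ w ∈ p.1.erase p.2, g (T.branch w))) •
          r (T.trunk p.1) := by
    intro e he
    have he0 := (mem_edges.mp he).1
    rw [Finset.smul_sum, ← Finset.sum_filter_add_sum_filter_not _ (fun c => ∀ w ∈ c, ¬ w <+: e)]
    have hbr : ∀ c ∈ (T.trunk {e}).simpleCuts, ∀ v ∈ c, ¬ v <+: e →
        (T.trunk {e}).branch v = T.branch v := by
      intro c hc v hv hve
      have h1 := (mem_edges_trunk_singleton he0).mp (mem_edges_of_mem_simpleCuts hc hv)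
      exact branch_trunk_of_not_prefix (mem_edges.mp h1.1).2 he0 h1.2 hve
    congr 1
    · refine Finset.sum_congr rfl fun c hc => ?_
      obtain ⟨hc, hce⟩ := Finset.mem_filter.mp hc
      rw [trunk_trunk, Finset.singleton_union, smul_assoc,
        Finset.prod_congr rfl fun v hv => by rw [hbr c hc v hv (hce v hv)]]
    · rw [Finset.sum_sigma, Finset.sum_filter]
      refine Finset.sum_congr rfl fun c hc => ?_
      by_cases hce : ∃ w ∈ c, w <+: e
      · rw [if_pos (by push Not; exact hce)]
        obtain ⟨w, hw, hwe⟩ := hce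
        have hc' := mem_simpleCuts.mp hc
        have huniq : ∀ v ∈ c, v <+: e → v = w := by
          intro v hv hve
          rcases List.prefix_or_prefix_of_prefix hve hwe with h | h
          · exact hc'.2 v hv w hw h
          · exact (hc'.2 w hw v hv h).symm
        have hfil : c.filter (· <+: e) = {w} := by
          ext v
          simp only [Finset.mem_filter, Finset.mem_singleton]
          exact ⟨fun h => huniq v h.1 h.2, by rintro rfl; exact ⟨hw, hwe⟩⟩
        have hw0 : w ≠ [] := (mem_edges.mp (mem_edges_of_mem_simpleCuts hc hw)).1
        rw [hfil, Finset.sum_singleton, trunk_trunk, Finset.singleton_union,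
          trunk_insert_of_prefix hw hw0 hwe, smul_assoc, ← Finset.mul_prod_erase c _ hw,
          Finset.prod_congr rfl fun v hv => by
            rw [hbr c hc v (Finset.mem_of_mem_erase hv) fun h =>
              (Finset.ne_of_mem_erase hv) (huniq v (Finset.mem_of_mem_erase hv) h)]]
      · push Not at hce
        rw [if_neg (not_not.mpr hce), Finset.filter_eq_empty_iff.mpr fun w hw => hce w hw,
          Finset.sum_empty]
  rw [edgeSum, Finset.sum_congr rfl hsplit, Finset.sum_add_distrib]
  simp only [add_mul, add_smul, Finset.sum_add_distrib]
  congr 1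
  -- No edge of the cut is above `e`: adding `e` gives a simple cut of `T`.
  · rw [Finset.sum_sigma', Finset.sum_sigma']
    refine Finset.sum_bij' (fun p _ => ⟨insert p.1 p.2, p.1⟩) (fun q _ => ⟨q.2, q.1.erase q.2⟩)
      ?_ ?_ ?_ ?_ ?_
    · rintro ⟨e, c⟩ h
      simp only [Finset.mem_sigma, Finset.mem_filter] at h ⊢
      exact ⟨insert_mem_simpleCuts h.1 h.2.1 h.2.2, Finset.mem_insert_self _ _⟩
    · rintro ⟨c, e⟩ h
      simp only [Finset.mem_sigma, Finset.mem_filter] at h ⊢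
      exact ⟨mem_edges_of_mem_simpleCuts h.1 h.2, erase_mem_simpleCuts h.1 h.2⟩
    · rintro ⟨e, c⟩ h
      simp only [Finset.mem_sigma, Finset.mem_filter] at h
      rw [Sigma.mk.injEq]
      exact ⟨rfl, heq_of_eq (Finset.erase_insert fun he => h.2.2 e he (List.prefix_refl e))⟩
    · rintro ⟨c, e⟩ h
      simp only [Finset.mem_sigma] at h
      rw [Sigma.mk.injEq]
      exact ⟨Finset.insert_erase h.2, heq_of_eq rfl⟩
    · rintro ⟨e, c⟩ h
      simp only [Finset.mem_sigma, Finset.mem_filter] at h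
      simp only [smul_mul_assoc, one_mul]
      rw [Finset.erase_insert fun he => h.2.2 e he (List.prefix_refl e)]
  -- The edge `p.2` of the cut `p.1` is above `e`: then `e` is an edge of the branch at `p.2`.
  · rw [Finset.sum_comm' (s' := fun p => T.edges.filter fun e => p.2 <+: e ∧ ¬ e <+: p.2)
      (t' := T.simpleCuts.sigma fun c => c), Finset.sum_sigma]
    · refine Finset.sum_congr rfl fun c hc => Finset.sum_congr rfl fun v hv => ?_
      have hvT := (mem_edges.mp (mem_edges_of_mem_simpleCuts hc hv)).2
      rw [sum_edges_prefix hvT, edgeSum, Finset.sum_mul, Finset.sum_smul]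
      refine Finset.sum_congr rfl fun w hw => ?_
      rw [mem_edges, mem_branch hvT] at hw
      rw [branch_branch hw.2, branch_trunk_append hvT hw.1, smul_mul_assoc]
    · rintro e ⟨c, w⟩
      simp only [Finset.mem_sigma, Finset.mem_filter]
      constructor
      · rintro ⟨he, hc, hw, hwe⟩
        have := (mem_simpleCuts_trunk_iff he hw hwe).mp hc
        exact ⟨⟨he, hwe, this.2⟩, this.1, hw⟩
      · rintro ⟨⟨he, hwe, hew⟩, hc, hw⟩
        exact ⟨he, (mem_simpleCuts_trunk_iff he hw hwe).mpr ⟨hc, hew⟩, hw, hwe⟩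

end CutSum

/-! ### The pre-Lie product -/

section PreLie

open Bonsai

variable (k : Type*) [Field k] {m : ℕ}

theorem cutCount_eq_card_edges (T₁ T₂ T : Bonsai m) :
    cutCount T₁ T₂ T = (T.edges.filter fun e => T.branch e = T₁ ∧ T.trunk {e} = T₂).card := by
  rw [cutCount, ← Finset.card_image_of_injective (T.edges.filter _) Finset.singleton_injective]
  congr 1
  ext c
  simp only [Finset.mem_filter, Finset.mem_image]
  constructor
  · rintro ⟨hc, h1, hp, ht⟩
    obtain ⟨e, rfl⟩ := Finset.card_eq_one.mp h1
    exact ⟨e, ⟨singleton_mem_simpleCuts.mp hc, by simpa [pruned] using hp, ht⟩, rfl⟩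
  · rintro ⟨e, ⟨he, hp, ht⟩, rfl⟩
    exact ⟨singleton_mem_simpleCuts.mpr he, Finset.card_singleton e, by simpa [pruned] using hp, ht⟩

theorem graft_apply (x y : L1 k m) (T : Bonsai m) : graft k m x y T = edgeSum x y T := by
  induction x using Finsupp.induction_linear with
  | zero => simp [edgeSum]
  | add x x' hx hx' => simp [edgeSum, add_mul, Finset.sum_add_distrib] at hx hx' ⊢; rw [hx, hx']
  | single T₁ a =>
    induction y using Finsupp.induction_linear with
    | zero => simp [edgeSum]
    | add y y' hy hy' => simp [edgeSum, mul_add, Finset.sum_add_distrib] at hy hy' ⊢; rw [hy, hy']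
    | single T₂ b =>
      simp only [graft, Finsupp.linearCombination_single, LinearMap.smul_apply, Finsupp.smul_apply,
        Finsupp.ofSupportFinite_coe, cutCount_eq_card_edges, edgeSum, Finsupp.single_apply,
        Finset.card_filter, Nat.cast_sum, Finset.mul_sum, smul_eq_mul]
      refine Finset.sum_congr rfl fun e _ => ?_
      simp only [eq_comm (a := T₁), eq_comm (a := T₂)]
      by_cases h1 : T.branch e = T₁ <;> by_cases h2 : T.trunk {e} = T₂ <;> simp [h1, h2]

theorem coe_graft (x y : L1 k m) : ⇑(graft k m x y) = edgeSum x y := funext (graft_apply k x y)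

theorem assoc_apply (x y z : L1 k m) (T : Bonsai m) :
    assoc k m x y z T = edgePairSum x y z T := by
  rw [assoc, Finsupp.sub_apply, graft_apply, graft_apply, coe_graft, coe_graft, edgeSum_edgeSum,
    add_sub_cancel_right]

theorem assoc_single_apply (T₁ T₂ T₃ T : Bonsai m) :
    assoc k m (Finsupp.single T₁ 1) (Finsupp.single T₂ 1) (Finsupp.single T₃ 1) T =
      (cutCount₂ T₁ T₂ T₃ T : k) := by
  rw [assoc_apply, edgePairSum, cutCount₂, Finset.card_filter, Nat.cast_sum, Finset.sum_product]
  refine Finset.sum_congr rfl fun e he => ?_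
  rw [Finset.sum_filter]
  refine Finset.sum_congr rfl fun f hf => ?_
  have hcut : (e ≠ f ∧ {e, f} ∈ T.simpleCuts) ↔ ¬ e <+: f ∧ ¬ f <+: e := by
    simp only [mem_simpleCuts, Finset.mem_insert, Finset.mem_singleton, forall_eq_or_imp, forall_eq]
    constructor
    · rintro ⟨h, -, h1, h2⟩
      exact ⟨fun h' => h (h1.2 h'), fun h' => h (h2.1 h').symm⟩
    · rintro ⟨h1, h2⟩
      exact ⟨fun h => h1 (h ▸ List.prefix_refl e), ⟨he, hf⟩, ⟨fun _ => trivial,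
        fun h => (h1 h).elim⟩, fun h => (h2 h).elim, fun _ => trivial⟩
  simp only [← and_assoc, hcut, Finsupp.single_apply, smul_eq_mul, eq_comm (a := T₁),
    eq_comm (a := T₂), eq_comm (a := T₃)]
  by_cases h0 : ¬ e <+: f ∧ ¬ f <+: e
  · by_cases h1 : T.branch e = T₁ <;> by_cases h2 : T.branch f = T₂ <;>
      by_cases h3 : T.trunk {e, f} = T₃ <;> simp [h0, h1, h2, h3]
  · simp only [h0, false_and, if_false, Nat.cast_zero]

theorem assoc_comm (x y z : L1 k m) : assoc k m x y z = assoc k m y x z := by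
  ext T
  rw [assoc_apply, assoc_apply, edgePairSum_comm]

theorem bracket_apply (x y : L1 k m) : bracket k m x y = graft k m x y - graft k m y x := rfl

theorem isLieBracket_bracket : IsLieBracket (bracket k m) where
  self x := by rw [bracket_apply, sub_self]
  jacobi x y z := by
    -- The Jacobi sum is an alternating sum of associators.
    have h1 := assoc_comm k x y z
    have h2 := assoc_comm k y z x
    have h3 := assoc_comm k z x y
    simp only [assoc] at h1 h2 h3
    simp only [bracket_apply, map_sub, LinearMap.sub_apply]
    linear_combination (norm := abel) -h1 - h2 - h3

end PreLie

/-! ### Infinitesimal characters -/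

section Functionals

open MvPolynomial

variable {k : Type*} [Field k] {m : ℕ}

/-- Functionals that are derivations along the counit are determined by the values on the
generators. -/
theorem eq_of_counit_derivation {f g : Module.Dual k (BonsaiAlg k m)}
    (hf : ∀ P Q, f (P * Q) = f P * counit k m Q + counit k m P * f Q)
    (hg : ∀ P Q, g (P * Q) = g P * counit k m Q + counit k m P * g Q)
    (h : ∀ T, f (X T) = g (X T)) : f = g := by
  have h1 : ∀ {f : Module.Dual k (BonsaiAlg k m)},
      (∀ P Q, f (P * Q) = f P * counit k m Q + counit k m P * f Q) → f 1 = 0 := by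
    intro f hf
    have := hf 1 1
    simp only [mul_one, map_one, one_mul] at this
    exact left_eq_add.mp this
  refine LinearMap.ext fun P => ?_
  induction P using MvPolynomial.induction_on with
  | C a => rw [← mul_one (C a), ← smul_eq_C_mul, map_smul, map_smul, h1 hf, h1 hg]
  | add P Q hP hQ => rw [map_add, map_add, hP, hQ]
  | mul_X P T hP => rw [hf, hg, hP, h]

theorem zMap_single (T : Bonsai m) (a : k) (P : BonsaiAlg k m) :
    zMap k m (Finsupp.single T a) P = a * counit k m (pderiv T P) := by
  simp [zMap]

theorem zMap_mul (x : L1 k m) (P Q : BonsaiAlg k m) :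
    zMap k m x (P * Q) = zMap k m x P * counit k m Q + counit k m P * zMap k m x Q := by
  induction x using Finsupp.induction_linear with
  | zero => simp
  | add x y hx hy => rw [map_add]; simp only [LinearMap.add_apply, hx, hy]; ring
  | single T a =>
    simp only [zMap_single, Derivation.leibniz, smul_eq_mul, map_add, map_mul]
    ring

@[simp]
theorem counit_X (T : Bonsai m) : counit k m (X T) = 0 := by simp [counit]

@[simp]
theorem zMap_X (x : L1 k m) (T : Bonsai m) : zMap k m x (X T) = x T := by
  induction x using Finsupp.induction_linear with
  | zero => simp
  | add x y hx hy => rw [map_add, LinearMap.add_apply, hx, hy, Finsupp.add_apply]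
  | single T' a =>
    classical
    rw [zMap_single, pderiv_X, Finsupp.single_apply, Pi.single_apply]
    by_cases h : T' = T
    · simp [h]
    · simp [h, Ne.symm h]

theorem zMap_injective : Function.Injective (zMap k m) := fun x y h => by
  ext T
  rw [← zMap_X, h, zMap_X]

end Functionals

/-! ### The derivations of the bonsai algebra given by `L¹` -/

section Derivation

open MvPolynomial Bonsai

variable {k : Type*} [Field k] {m : ℕ}

/-- The transpose of the left multiplication by `x ∈ L¹` in the dual of the bonsai algebra: the
derivation that takes `δ_T` to `⟨x, δ_T⟩ + ∑_e ⟨x, δ_{T_e}⟩ δ_{T \ e}`, where the edge `e` separates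
`T` into the branch `T_e` and the trunk `T \ e`. -/
noncomputable def cutDer (x : L1 k m) : Derivation k (BonsaiAlg k m) (BonsaiAlg k m) :=
  mkDerivation k fun T => C (x T) + edgeSum x X T

@[simp]
theorem cutDer_X (x : L1 k m) (T : Bonsai m) : cutDer x (X T) = C (x T) + edgeSum x X T :=
  mkDerivation_X _ _ _

theorem edgeSum_add_left (x y : Bonsai m → k) {M : Type*} [AddCommMonoid M] [Module k M]
    (z : Bonsai m → M) (T : Bonsai m) : edgeSum (x + y) z T = edgeSum x z T + edgeSum y z T := by
  simp [edgeSum, add_smul, Finset.sum_add_distrib]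

theorem edgeSum_smul_left (a : k) (x : Bonsai m → k) {M : Type*} [AddCommMonoid M] [Module k M]
    (z : Bonsai m → M) (T : Bonsai m) : edgeSum (a • x) z T = a • edgeSum x z T := by
  simp [edgeSum, mul_smul, Finset.smul_sum]

theorem edgeSum_add_right (x : Bonsai m → k) {M : Type*} [AddCommMonoid M] [Module k M]
    (z w : Bonsai m → M) (T : Bonsai m) :
    edgeSum x (fun T => z T + w T) T = edgeSum x z T + edgeSum x w T := by
  simp [edgeSum, Finset.sum_add_distrib]

theorem map_edgeSum {M N F : Type*} [AddCommMonoid M] [AddCommMonoid N] [Module k M] [Module k N]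
    [FunLike F M N] [AddMonoidHomClass F M N] [MulActionHomClass F k M N] (φ : F)
    (x : Bonsai m → k) (z : Bonsai m → M) (T : Bonsai m) :
    φ (edgeSum x z T) = edgeSum x (fun T => φ (z T)) T := by
  simp [edgeSum, map_sum]

theorem cutDer_add (x y : L1 k m) : cutDer (x + y) = cutDer x + cutDer y := by
  refine derivation_ext fun T => ?_
  rw [Derivation.add_apply, cutDer_X, cutDer_X, cutDer_X, Finsupp.coe_add, edgeSum_add_left,
    Pi.add_apply, map_add]
  abel

theorem cutDer_smul (a : k) (x : L1 k m) : cutDer (a • x) = a • cutDer x := by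
  refine derivation_ext fun T => ?_
  rw [Derivation.smul_apply, cutDer_X, cutDer_X, Finsupp.coe_smul, edgeSum_smul_left,
    Pi.smul_apply, smul_add, smul_eq_mul, C_mul, ← smul_eq_C_mul]

theorem cutDer_edgeSum (y : L1 k m) (x : Bonsai m → k) (z : Bonsai m → BonsaiAlg k m)
    (T : Bonsai m) : cutDer y (edgeSum x z T) = edgeSum x (fun T => cutDer y (z T)) T :=
  map_edgeSum (cutDer y).toLinearMap x z T

/-- The pre-Lie identity, in the form of a representation of the Lie algebra `L¹` from the
right. -/
theorem cutDer_bracket (x y : L1 k m) (P : BonsaiAlg k m) :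
    cutDer (bracket k m x y) P = cutDer y (cutDer x P) - cutDer x (cutDer y P) := by
  rw [← Derivation.commutator_apply]
  congr 1
  refine derivation_ext fun T => ?_
  have h : ∀ x y : L1 k m, cutDer y (cutDer x (X T)) =
      C (graft k m x y T) + (edgePairSum x y X T + edgeSum (graft k m x y) X T) := by
    intro x y
    rw [cutDer_X, map_add, derivation_C, zero_add, cutDer_edgeSum, coe_graft, ← edgeSum_edgeSum]
    simp only [cutDer_X]
    rw [edgeSum_add_right, ← algebraMap_eq, ← Algebra.linearMap_apply, map_edgeSum]
    rfl
  -- The sums over pairs of edges on no common path cancel by symmetry.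
  have h' : bracket k m x y = graft k m x y + (-1 : k) • graft k m y x := by
    rw [bracket_apply, neg_one_smul, sub_eq_add_neg]
  rw [Derivation.commutator_apply, h, h, edgePairSum_comm, cutDer_X, h', Finsupp.coe_add,
    edgeSum_add_left, Finsupp.coe_smul, edgeSum_smul_left, Pi.add_apply, Pi.smul_apply, map_add,
    neg_one_smul, neg_one_smul, map_neg]
  abel

theorem counit_cutDer (x : L1 k m) (P : BonsaiAlg k m) :
    counit k m (cutDer x P) = zMap k m x P := by
  refine LinearMap.congr_fun (eq_of_counit_derivation
    (f := (counit k m).toLinearMap ∘ₗ (cutDer x).toLinearMap) (fun P Q => ?_) (zMap_mul x)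
    fun T => ?_) P
  · simp
    ring
  · have h : counit k m (edgeSum x X T) = 0 := by
      rw [map_edgeSum]
      simp [edgeSum]
    simp only [LinearMap.comp_apply, Derivation.coeFn_coe,
      AlgHom.toLinearMap_apply, cutDer_X, map_add, h, zMap_X, add_zero]
    simp [counit]

theorem forest_pruned (T : Bonsai m) (c : Finset (List (Fin m))) :
    forest k (T.pruned c) = ∏ v ∈ c, X (T.branch v) := by
  rw [forest, pruned, Multiset.map_map]
  rfl

theorem comul_X (T : Bonsai m) : comul k m (X T) = X T ⊗ₜ[k] 1 +
    ∑ c ∈ T.simpleCuts, (∏ v ∈ c, X (T.branch v)) ⊗ₜ[k] X (T.trunk c) := by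
  simp only [comul, aeval_X, forest_pruned]

theorem derivation_prod {ι A M : Type*} [CommSemiring A] [Algebra k A] [AddCommMonoid M]
    [Module A M] [Module k M] [DecidableEq ι] (D : Derivation k A M) (s : Finset ι) (f : ι → A) :
    D (∏ i ∈ s, f i) = ∑ i ∈ s, (∏ j ∈ s.erase i, f j) • D (f i) := by
  induction s using Finset.induction_on with
  | empty => simp
  | insert a s ha ih =>
    rw [Finset.prod_insert ha, Finset.sum_insert ha, Finset.erase_insert ha, D.leibniz, ih,
      Finset.smul_sum, add_comm]
    congr 1
    refine Finset.sum_congr rfl fun i hi => ?_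
    have hia : i ≠ a := fun h => ha (h ▸ hi)
    rw [Finset.erase_insert_of_ne hia.symm, Finset.prod_insert (by simp [ha]), mul_smul]

theorem rTensor_derivation_mul {A B : Type*} [CommRing A] [CommRing B] [Algebra k A] [Algebra k B]
    (D : Derivation k A A) (s t : A ⊗[k] B) :
    D.toLinearMap.rTensor B (s * t) =
      s * D.toLinearMap.rTensor B t + t * D.toLinearMap.rTensor B s := by
  induction s with
  | zero => simp
  | add s s' hs hs' => rw [add_mul, map_add, hs, hs', map_add]; ring
  | tmul a b =>
    induction t with
    | zero => simp
    | add t t' ht ht' => rw [mul_add, map_add, ht, ht', map_add]; ring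
    | tmul a' b' =>
      simp only [Algebra.TensorProduct.tmul_mul_tmul, LinearMap.rTensor_tmul,
        Derivation.coeFn_coe, Derivation.leibniz, smul_eq_mul,
        TensorProduct.add_tmul, mul_comm b' b]

/-- Coassociativity, as far as it involves elements of `L¹`: the derivation `cutDer x` commutes
with the right coaction of the bonsai algebra on itself. -/
theorem comul_cutDer (x : L1 k m) (P : BonsaiAlg k m) :
    comul k m (cutDer x P) = (cutDer x).toLinearMap.rTensor _ (comul k m P) := by
  induction P using MvPolynomial.induction_on with
  | C a =>
    rw [derivation_C, map_zero, ← algebraMap_eq, AlgHom.commutes,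
      Algebra.TensorProduct.algebraMap_apply, LinearMap.rTensor_tmul]
    simp
  | add P Q hP hQ => simp only [map_add, hP, hQ]
  | mul_X P T hP =>
    have hX : comul k m (cutDer x (X T)) =
        (cutDer x).toLinearMap.rTensor _ (comul k m (X T)) := by
      have h1 : ∀ T : Bonsai m, comul k m (X T) = X T ⊗ₜ[k] 1 + ∑ c ∈ T.simpleCuts,
          (∏ v ∈ c, X (T.branch v) : BonsaiAlg k m) •
            ((1 : BonsaiAlg k m) ⊗ₜ[k] (X (T.trunk c) : BonsaiAlg k m)) := by
        intro T
        rw [comul_X]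
        simp only [TensorProduct.smul_tmul', smul_eq_mul, mul_one]
      have h2 : ∀ a : k, comul k m (C a) = (C a : BonsaiAlg k m) ⊗ₜ[k] 1 := fun a => by
        rw [← algebraMap_eq, AlgHom.commutes, Algebra.TensorProduct.algebraMap_apply]
      rw [cutDer_X, map_add, map_edgeSum]
      simp only [h1]
      rw [edgeSum_add_right, sum_edges_sum_simpleCuts x X
        (fun T => (1 : BonsaiAlg k m) ⊗ₜ[k] (X T : BonsaiAlg k m)), h2, ← add_assoc, map_add,
        LinearMap.rTensor_tmul]
      congr 1
      · rw [Derivation.coeFn_coe, cutDer_X, TensorProduct.add_tmul]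
        simp [edgeSum, TensorProduct.sum_tmul, TensorProduct.smul_tmul']
      · rw [map_sum]
        refine Finset.sum_congr rfl fun c _ => ?_
        rw [TensorProduct.smul_tmul', smul_eq_mul, mul_one, LinearMap.rTensor_tmul,
          Derivation.coeFn_coe, derivation_prod,
          TensorProduct.sum_tmul]
        refine Finset.sum_congr rfl fun v _ => ?_
        rw [TensorProduct.smul_tmul', smul_eq_mul, mul_one, cutDer_X, smul_eq_mul, mul_comm,
          smul_eq_C_mul, mul_one]
    rw [Derivation.leibniz, map_add, smul_eq_mul, smul_eq_mul, map_mul, map_mul, hP, hX, map_mul,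
      rTensor_derivation_mul]

/-- The counit axiom on the left: only the empty cut has an empty forest of branches. -/
theorem counit_rTensor_comul (P : BonsaiAlg k m) :
    (counit k m).toLinearMap.rTensor _ (comul k m P) = 1 ⊗ₜ[k] P := by
  have h : (Algebra.TensorProduct.map (counit k m) (AlgHom.id k (BonsaiAlg k m))).comp
      (comul k m) = Algebra.TensorProduct.includeRight := by
    refine algHom_ext fun T => ?_
    rw [AlgHom.comp_apply, comul_X, map_add, map_sum, Finset.sum_eq_single ∅]
    · simp [trunk_empty]
    · intro c _ hc
      obtain ⟨v, hv⟩ := Finset.nonempty_iff_ne_empty.mpr hc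
      rw [Algebra.TensorProduct.map_tmul, map_prod, Finset.prod_eq_zero hv (counit_X _),
        TensorProduct.zero_tmul]
    · exact fun h => (h empty_mem_simpleCuts).elim
  exact AlgHom.congr_fun h P

theorem dualDistrib_comp_rTensor {A B A' : Type*} [AddCommGroup A] [Module k A] [AddCommGroup A']
    [Module k A'] [AddCommGroup B] [Module k B] (φ : A →ₗ[k] A') (f : Module.Dual k A')
    (g : Module.Dual k B) (t : A ⊗[k] B) :
    TensorProduct.dualDistrib k A' B (f ⊗ₜ g) (φ.rTensor B t) =
      TensorProduct.dualDistrib k A B ((f ∘ₗ φ) ⊗ₜ g) t := by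
  induction t with
  | zero => simp
  | add s t hs ht => simp only [map_add, hs, ht]
  | tmul a b => simp

theorem dualMul_counit (f : Module.Dual k (BonsaiAlg k m)) :
    dualMul (bonsaiHopf k m) (counit k m).toLinearMap f = f := by
  refine LinearMap.ext fun P => ?_
  have h := congrArg (TensorProduct.dualDistrib k k (BonsaiAlg k m) (LinearMap.id ⊗ₜ f))
    (counit_rTensor_comul P)
  rw [dualDistrib_comp_rTensor, LinearMap.id_comp, TensorProduct.dualDistrib_apply,
    LinearMap.id_apply, one_mul] at h
  exact h

/-- The left multiplication by `g ∘ cutDer x` in the dual of the bonsai algebra, when the one by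
`g` is known. -/
theorem dualMul_comp_cutDer (x : L1 k m) (f g : Module.Dual k (BonsaiAlg k m)) :
    dualMul (bonsaiHopf k m) (g ∘ₗ (cutDer x).toLinearMap) f =
      dualMul (bonsaiHopf k m) g f ∘ₗ (cutDer x).toLinearMap := by
  refine LinearMap.ext fun P => ?_
  have h := congrArg (TensorProduct.dualDistrib k _ _ (g ⊗ₜ f)) (comul_cutDer x P)
  rw [dualDistrib_comp_rTensor] at h
  exact h.symm

theorem dualMul_zMap (x : L1 k m) (f : Module.Dual k (BonsaiAlg k m)) :
    dualMul (bonsaiHopf k m) (zMap k m x) f = f ∘ₗ (cutDer x).toLinearMap := by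
  have h : zMap k m x = (counit k m).toLinearMap ∘ₗ (cutDer x).toLinearMap :=
    LinearMap.ext fun P => (counit_cutDer x P).symm
  rw [h, dualMul_comp_cutDer, dualMul_counit]

theorem zMap_bracket (x y : L1 k m) : zMap k m (bracket k m x y) =
    dualMul (bonsaiHopf k m) (zMap k m x) (zMap k m y) -
      dualMul (bonsaiHopf k m) (zMap k m y) (zMap k m x) := by
  refine LinearMap.ext fun P => ?_
  rw [dualMul_zMap, dualMul_zMap, ← counit_cutDer, cutDer_bracket, map_sub, counit_cutDer,
    counit_cutDer]
  rfl

end Derivation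

/-! ### The pairing of the enveloping algebra with the bonsai algebra -/

section EnvGeneral

variable {k : Type*} [Field k] {𝔤 : Type*} [LieRing 𝔤] [LieAlgebra k 𝔤]

/-- The enveloping algebra is spanned by the results of multiplying `1` from the left by elements
of the Lie algebra. -/
theorem env_left_induction {p : UniversalEnvelopingAlgebra k 𝔤 → Prop} (one : p 1)
    (add : ∀ u v, p u → p v → p (u + v)) (smul : ∀ (a : k) u, p u → p (a • u))
    (ι_mul : ∀ x u, p u → p (UniversalEnvelopingAlgebra.ι k x * u))
    (u : UniversalEnvelopingAlgebra k 𝔤) : p u := by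
  obtain ⟨a, rfl⟩ : ∃ a, UniversalEnvelopingAlgebra.mkAlgHom k 𝔤 a = u :=
    RingCon.mkₐ_surjective (α := k) (UniversalEnvelopingAlgebra.ringCon k 𝔤) u
  suffices h : ∀ w, p w → p (UniversalEnvelopingAlgebra.mkAlgHom k 𝔤 a * w) by
    simpa using h 1 one
  induction a using TensorAlgebra.induction with
  | algebraMap r =>
    intro w hw
    rw [AlgHom.commutes, ← Algebra.smul_def]
    exact smul r w hw
  | ι x => exact ι_mul x
  | mul a b ha hb =>
    intro w hw
    rw [map_mul, mul_assoc]
    exact ha _ (hb _ hw)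
  | add a b ha hb =>
    intro w hw
    rw [map_add, add_mul]
    exact add _ _ (ha _ hw) (hb _ hw)

theorem env_algHom_ext {A : Type*} [Semiring A] [Algebra k A]
    {f g : UniversalEnvelopingAlgebra k 𝔤 →ₐ[k] A}
    (hfg : ∀ x, f (UniversalEnvelopingAlgebra.ι k x) = g (UniversalEnvelopingAlgebra.ι k x)) :
    f = g := by
  refine AlgHom.ext fun u => ?_
  induction u using env_left_induction with
  | one => rw [map_one, map_one]
  | add u v hu hv => rw [map_add, map_add, hu, hv]
  | smul a u hu => rw [map_smul, map_smul, hu]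
  | ι_mul x u hu => rw [map_mul, map_mul, hfg, hu]

theorem envComul_ι (x : 𝔤) : envComul k 𝔤 (UniversalEnvelopingAlgebra.ι k x) =
    UniversalEnvelopingAlgebra.ι k x ⊗ₜ[k] 1 + 1 ⊗ₜ[k] UniversalEnvelopingAlgebra.ι k x :=
  UniversalEnvelopingAlgebra.lift_ι_apply k _ x

theorem envCounit_ι (x : 𝔤) : envCounit k 𝔤 (UniversalEnvelopingAlgebra.ι k x) = 0 :=
  UniversalEnvelopingAlgebra.lift_ι_apply k _ x

theorem envHopf_antipode_ι_mul (x : 𝔤) (u : UniversalEnvelopingAlgebra k 𝔤) :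
    (envHopf k 𝔤).antipode (UniversalEnvelopingAlgebra.ι k x * u) =
      -((envHopf k 𝔤).antipode u * UniversalEnvelopingAlgebra.ι k x) := by
  have h : envAntipodeOp k 𝔤 (UniversalEnvelopingAlgebra.ι k x) =
      MulOpposite.op (-UniversalEnvelopingAlgebra.ι k x) :=
    UniversalEnvelopingAlgebra.lift_ι_apply k _ x
  simp [envHopf, h, -UniversalEnvelopingAlgebra.ι_apply]

end EnvGeneral

section Pairing

open MvPolynomial Bonsai

variable {k : Type*} [Field k] {m : ℕ} (h : IsLieBracket (bracket k m))

/-- The action of `U(L¹)` from the right on the bonsai algebra in which `x ∈ L¹` acts by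
`cutDer x`. -/
noncomputable def envAct : EnvL1 k m h →ₐ[k] (Module.End k (BonsaiAlg k m))ᵐᵒᵖ :=
  UniversalEnvelopingAlgebra.lift k
    { toFun := fun x => MulOpposite.op (cutDer ((toLieOf h).symm x)).toLinearMap
      map_add' := fun x y => by
        rw [map_add, cutDer_add, ← MulOpposite.op_add]
        rfl
      map_smul' := fun a x => by
        rw [map_smul, cutDer_smul, RingHom.id_apply, ← MulOpposite.op_smul]
        rfl
      map_lie' := fun {x y} => by
        rw [LieRing.of_associative_ring_bracket, ← MulOpposite.op_mul, ← MulOpposite.op_mul,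
          ← MulOpposite.op_sub]
        congr 1
        exact LinearMap.ext fun P => cutDer_bracket _ _ P }

/-- The pairing `⟨u, P⟩` of `U(L¹)` with the bonsai algebra: the counit of the result of acting
on `P` by `u`. -/
noncomputable def envPairing : EnvL1 k m h →ₗ[k] Module.Dual k (BonsaiAlg k m) :=
  LinearMap.compRight k (counit k m).toLinearMap ∘ₗ
    (MulOpposite.opLinearEquiv k).symm.toLinearMap ∘ₗ (envAct h).toLinearMap

theorem envPairing_one : envPairing h 1 = (counit k m).toLinearMap := by
  refine LinearMap.ext fun P => ?_
  simp [envPairing]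

theorem envPairing_ι_mul (x : L1 k m) (u : EnvL1 k m h) :
    envPairing h (UniversalEnvelopingAlgebra.ι k (toLieOf h x) * u) =
      envPairing h u ∘ₗ (cutDer x).toLinearMap := by
  have hx : envAct h (UniversalEnvelopingAlgebra.ι k (toLieOf h x)) =
      MulOpposite.op (cutDer x).toLinearMap := UniversalEnvelopingAlgebra.lift_ι_apply k _ _
  refine LinearMap.ext fun P => ?_
  simp [envPairing, hx, -UniversalEnvelopingAlgebra.ι_apply]

theorem envPairing_envIncl (x : L1 k m) : envPairing h (envIncl k m h x) = zMap k m x := by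
  have h1 := envPairing_ι_mul h x 1
  rw [mul_one, envPairing_one] at h1
  exact h1.trans (LinearMap.ext fun P => counit_cutDer x P)

theorem envPairing_mul (u v : EnvL1 k m h) : envPairing h (u * v) =
    dualMul (bonsaiHopf k m) (envPairing h u) (envPairing h v) := by
  induction u using env_left_induction with
  | one => rw [one_mul, envPairing_one, dualMul_counit]
  | add u u' hu hu' =>
    rw [add_mul, map_add, map_add, hu, hu', dualMul, dualMul, dualMul, TensorProduct.add_tmul,
      map_add, LinearMap.add_comp]
  | smul a u hu =>
    rw [smul_mul_assoc, map_smul, map_smul, hu, dualMul, dualMul, ← TensorProduct.smul_tmul',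
      map_smul, LinearMap.smul_comp]
  | ι_mul x u hu =>
    obtain ⟨x, rfl⟩ := (toLieOf h).surjective x
    rw [mul_assoc, envPairing_ι_mul, envPairing_ι_mul, hu, dualMul_comp_cutDer]

theorem dualDistrib_envPairing_ι_mul (x : L1 k m) (t : EnvL1 k m h ⊗[k] EnvL1 k m h)
    (P Q : BonsaiAlg k m) :
    TensorProduct.dualDistrib k _ _ (TensorProduct.map (envPairing h) (envPairing h)
      (envComul k _ (UniversalEnvelopingAlgebra.ι k (toLieOf h x)) * t)) (P ⊗ₜ Q) =
    TensorProduct.dualDistrib k _ _ (TensorProduct.map (envPairing h) (envPairing h) t)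
      (cutDer x P ⊗ₜ Q + P ⊗ₜ cutDer x Q) := by
  rw [envComul_ι]
  induction t with
  | zero => simp
  | add s t hs ht => simp only [mul_add, map_add, LinearMap.add_apply] at hs ht ⊢; rw [hs, ht]; ring
  | tmul u v =>
    simp only [add_mul, Algebra.TensorProduct.tmul_mul_tmul, one_mul, map_add,
      TensorProduct.map_tmul, LinearMap.add_apply, TensorProduct.dualDistrib_apply,
      envPairing_ι_mul, LinearMap.comp_apply, Derivation.coeFn_coe]

theorem dualDistrib_envPairing_envComul (u : EnvL1 k m h) (P Q : BonsaiAlg k m) :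
    TensorProduct.dualDistrib k _ _ (TensorProduct.map (envPairing h) (envPairing h)
      (envComul k _ u)) (P ⊗ₜ Q) = envPairing h u (P * Q) := by
  induction u using env_left_induction generalizing P Q with
  | one =>
    rw [map_one, envPairing_one, Algebra.TensorProduct.one_def, TensorProduct.map_tmul,
      envPairing_one, TensorProduct.dualDistrib_apply]
    simp
  | add u v hu hv => simp only [map_add, LinearMap.add_apply, hu, hv]
  | smul a u hu => simp only [map_smul, LinearMap.smul_apply, hu]
  | ι_mul x u hu =>
    obtain ⟨x, rfl⟩ := (toLieOf h).surjective x
    rw [map_mul, dualDistrib_envPairing_ι_mul, map_add, hu, hu, envPairing_ι_mul,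
      LinearMap.comp_apply, Derivation.coeFn_coe, Derivation.leibniz, ← map_add, smul_eq_mul,
      smul_eq_mul]
    congr 1
    ring

theorem envPairing_apply_one (u : EnvL1 k m h) : envPairing h u 1 = envCounit k _ u := by
  induction u using env_left_induction with
  | one => rw [envPairing_one, AlgHom.toLinearMap_apply, map_one, map_one]
  | add u v hu hv => simp only [map_add, LinearMap.add_apply, hu, hv]
  | smul a u hu => simp only [map_smul, LinearMap.smul_apply, hu]
  | ι_mul x u hu =>
    obtain ⟨x, rfl⟩ := (toLieOf h).surjective x
    rw [envPairing_ι_mul, map_mul, envCounit_ι]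
    simp

end Pairing

/-! ### The pairing of products of generators with forests -/

section Forests

open MvPolynomial Bonsai

variable {k : Type*} [Field k] {m : ℕ}

@[simp]
theorem forest_zero : forest k (0 : Multiset (Bonsai m)) = 1 := by simp [forest]

@[simp]
theorem forest_cons (T : Bonsai m) (F : Multiset (Bonsai m)) :
    forest k (T ::ₘ F) = X T * forest k F := by simp [forest]

/-- The degree of a forest is its number of vertices. -/
def forestDeg (F : Multiset (Bonsai m)) : ℕ := (F.map deg).sum

theorem forest_eq_monomial (F : Multiset (Bonsai m)) :
    forest k F = monomial (Multiset.toFinsupp F) 1 := by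
  induction F using Multiset.induction_on with
  | empty => simp
  | cons T F ih =>
    rw [forest_cons, ih, ← Multiset.singleton_add, map_add, Multiset.toFinsupp_singleton, X,
      monomial_mul, one_mul]

theorem weight_toFinsupp (F : Multiset (Bonsai m)) :
    Finsupp.weight deg (Multiset.toFinsupp F) = forestDeg F := by
  induction F using Multiset.induction_on with
  | empty => simp [forestDeg]
  | cons T F ih =>
    rw [← Multiset.singleton_add, map_add, map_add, ih, Multiset.toFinsupp_singleton,
      Finsupp.weight_single]
    simp [forestDeg]

theorem forest_mem_bonsaiGrading (F : Multiset (Bonsai m)) :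
    forest k F ∈ bonsaiGrading k m (forestDeg F) := by
  rw [forest_eq_monomial]
  exact isWeightedHomogeneous_monomial _ _ _ (weight_toFinsupp F)

theorem bonsaiGrading_eq_span (n : ℕ) :
    bonsaiGrading k m n = Submodule.span k (forest k '' {F | forestDeg F = n}) := by
  refine le_antisymm (fun P hP => ?_) (Submodule.span_le.mpr ?_)
  · rw [P.as_sum]
    refine Submodule.sum_mem _ fun s hs => ?_
    rw [← mul_one (coeff s P), ← smul_eq_mul, ← smul_monomial]
    refine Submodule.smul_mem _ _ (Submodule.subset_span ⟨Finsupp.toMultiset s, ?_, ?_⟩)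
    · rw [Set.mem_ofPred_eq, ← weight_toFinsupp, Finsupp.toMultiset_toFinsupp]
      exact hP (mem_support_iff.mp hs)
    · rw [forest_eq_monomial, Finsupp.toMultiset_toFinsupp]
  · rintro _ ⟨F, rfl, rfl⟩
    exact forest_mem_bonsaiGrading F

variable (k m) in
theorem span_forest : Submodule.span k (Set.range (forest k (m := m))) = ⊤ := by
  refine eq_top_iff.mpr fun P _ => ?_
  rw [P.as_sum]
  refine Submodule.sum_mem _ fun s _ => ?_
  rw [← mul_one (coeff s P), ← smul_eq_mul, ← smul_monomial]
  refine Submodule.smul_mem _ _ (Submodule.subset_span ⟨Finsupp.toMultiset s, ?_⟩)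
  rw [forest_eq_monomial, Finsupp.toMultiset_toFinsupp]

theorem counit_forest {F : Multiset (Bonsai m)} (hF : F ≠ 0) : counit k m (forest k F) = 0 := by
  obtain ⟨T, hT⟩ := Multiset.exists_mem_of_ne_zero hF
  obtain ⟨G, rfl⟩ := Multiset.exists_cons_of_mem hT
  simp

variable (h : IsLieBracket (bracket k m))

/-- The product in `U(L¹)` of the generators `Z_T`, for `T` in a list. -/
noncomputable def zProd (l : List (Bonsai m)) : EnvL1 k m h :=
  (l.map fun T => envIncl k m h (Finsupp.single T 1)).prod

theorem zProd_cons (T : Bonsai m) (l : List (Bonsai m)) :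
    zProd h (T :: l) = envIncl k m h (Finsupp.single T 1) * zProd h l := by simp [zProd]

theorem zProd_mem_envGrading (l : List (Bonsai m)) :
    zProd h l ∈ envGrading k m h (l.map deg).sum :=
  Submodule.subset_span ⟨l, rfl, rfl⟩

theorem envPairing_zProd_cons (T : Bonsai m) (l : List (Bonsai m)) (P : BonsaiAlg k m) :
    envPairing h (zProd h (T :: l)) P =
      envPairing h (zProd h l) (cutDer (Finsupp.single T 1) P) := by
  rw [zProd_cons]
  exact LinearMap.congr_fun (envPairing_ι_mul h _ _) P

/-- The derivation given by `Z_T` lowers degrees by `deg T`. -/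
theorem cutDer_single_forest_mem (T : Bonsai m) (F : Multiset (Bonsai m)) :
    cutDer (Finsupp.single T 1) (forest k F) ∈
      Submodule.span k (forest k '' {G | T.deg + forestDeg G = forestDeg F}) := by
  induction F using Multiset.induction_on with
  | empty => simp
  | cons T' F ih =>
    rw [forest_cons, Derivation.leibniz]
    refine Submodule.add_mem _ ?_ ?_
    · refine Submodule.span_induction (p := fun P _ => X T' • P ∈ Submodule.span k (forest k ''
        {G | T.deg + forestDeg G = forestDeg (T' ::ₘ F)})) ?_ ?_ ?_ ?_ ih
      · rintro _ ⟨G, hG, rfl⟩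
        refine Submodule.subset_span ⟨T' ::ₘ G, ?_, by rw [forest_cons, smul_eq_mul]⟩
        simp only [forestDeg, Set.mem_ofPred_eq, Multiset.map_cons, Multiset.sum_cons] at hG ⊢
        omega
      · rw [smul_zero]
        exact Submodule.zero_mem _
      · intro P Q _ _ hP hQ
        rw [smul_add]
        exact Submodule.add_mem _ hP hQ
      · intro a P _ hP
        rw [smul_comm]
        exact Submodule.smul_mem _ _ hP
    · rw [cutDer_X, smul_add]
      refine Submodule.add_mem _ ?_ ?_
      · rw [smul_eq_mul, mul_comm, ← smul_eq_C_mul, Finsupp.single_apply]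
        by_cases hT : T = T'
        · subst hT
          refine Submodule.smul_mem _ _ (Submodule.subset_span ⟨F, ?_, rfl⟩)
          simp [forestDeg]
        · rw [if_neg hT, zero_smul]
          exact Submodule.zero_mem _
      · rw [edgeSum, Finset.smul_sum]
        refine Submodule.sum_mem _ fun e he => ?_
        rw [smul_comm, Finsupp.single_apply]
        by_cases hT : T = T'.branch e
        · refine Submodule.smul_mem _ _ (Submodule.subset_span ⟨T'.trunk {e} ::ₘ F, ?_, ?_⟩)
          · have := deg_trunk_add_deg_branch he
            simp only [forestDeg, Set.mem_ofPred_eq, Multiset.map_cons, Multiset.sum_cons, hT]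
            omega
          · rw [forest_cons, smul_eq_mul, mul_comm]
        · rw [if_neg hT, zero_smul]
          exact Submodule.zero_mem _

theorem envPairing_zProd_forest_of_deg_ne (l : List (Bonsai m)) (F : Multiset (Bonsai m))
    (hl : (l.map deg).sum ≠ forestDeg F) : envPairing h (zProd h l) (forest k F) = 0 := by
  induction l generalizing F with
  | nil =>
    have hF : F ≠ 0 := by
      rintro rfl
      simp [forestDeg] at hl
    rw [zProd, List.map_nil, List.prod_nil, envPairing_one]
    exact counit_forest hF
  | cons T l ih =>
    rw [envPairing_zProd_cons]
    refine Submodule.span_induction (p := fun P _ => envPairing h (zProd h l) P = 0) ?_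
      (map_zero _) ?_ ?_ (cutDer_single_forest_mem T F)
    · rintro _ ⟨G, hG, rfl⟩
      refine ih G fun hlG => hl ?_
      rw [Set.mem_ofPred_eq] at hG
      rw [List.map_cons, List.sum_cons, hlG, hG]
    · intro P Q _ _ hP hQ
      rw [map_add, hP, hQ, add_zero]
    · intro a P _ hP
      rw [map_smul, hP, smul_zero]

variable (k m) in
/-- The augmentation ideal of the bonsai algebra. -/
noncomputable def augIdeal : Ideal (BonsaiAlg k m) := RingHom.ker (counit k m)

theorem mem_augIdeal {P : BonsaiAlg k m} : P ∈ augIdeal k m ↔ counit k m P = 0 := Iff.rfl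

theorem forest_mem_augIdeal_pow (F : Multiset (Bonsai m)) :
    forest k F ∈ augIdeal k m ^ F.card := by
  induction F using Multiset.induction_on with
  | empty => simp
  | cons T F ih =>
    rw [forest_cons, Multiset.card_cons, pow_succ']
    exact Ideal.mul_mem_mul (mem_augIdeal.mpr (counit_X T)) ih

theorem derivation_mem_ideal_pow {A : Type*} [CommRing A] [Algebra k A] (D : Derivation k A A)
    (I : Ideal A) (s : ℕ) {P : A} (hP : P ∈ I ^ (s + 1)) : D P ∈ I ^ s := by
  induction s generalizing P with
  | zero => simp
  | succ s ih =>
    rw [pow_succ'] at hP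
    induction hP using Submodule.mul_induction_on' with
    | mem_mul_mem a ha b hb =>
      rw [D.leibniz, smul_eq_mul, smul_eq_mul]
      refine Ideal.add_mem _ ?_ (Ideal.mul_mem_right _ _ hb)
      rw [pow_succ']
      exact Ideal.mul_mem_mul ha (ih hb)
    | add x _ y _ hx hy => rw [map_add]; exact Ideal.add_mem _ hx hy

theorem derivation_mem_ideal_pow_of_le {A : Type*} [CommRing A] [Algebra k A]
    (D : Derivation k A A) (I : Ideal A) (hD : ∀ P ∈ I, D P ∈ I) (s : ℕ) {P : A}
    (hP : P ∈ I ^ s) : D P ∈ I ^ s := by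
  induction s generalizing P with
  | zero => simp
  | succ s ih =>
    rw [pow_succ'] at hP ⊢
    induction hP using Submodule.mul_induction_on' with
    | mem_mul_mem a ha b hb =>
      rw [D.leibniz, smul_eq_mul, smul_eq_mul, mul_comm b]
      exact Ideal.add_mem _ (Ideal.mul_mem_mul ha (ih hb)) (Ideal.mul_mem_mul (hD a ha) hb)
    | add x _ y _ hx hy => rw [map_add]; exact Ideal.add_mem _ hx hy

/-- A product of `r` elements of `L¹` vanishes on products of more than `r` elements of the
augmentation ideal. -/
theorem envPairing_zProd_of_mem_augIdeal_pow (l : List (Bonsai m)) {P : BonsaiAlg k m}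
    (hP : P ∈ augIdeal k m ^ (l.length + 1)) : envPairing h (zProd h l) P = 0 := by
  induction l generalizing P with
  | nil =>
    rw [zProd, List.map_nil, List.prod_nil, envPairing_one]
    rw [List.length_nil, zero_add, pow_one] at hP
    exact hP
  | cons T l ih =>
    rw [envPairing_zProd_cons]
    exact ih (derivation_mem_ideal_pow _ _ _ hP)

/-- In the pairing of a product of `r` elements of `L¹` with an element of the `r`-th power of
the augmentation ideal, only the constant part of the action on the generators matters. -/
theorem envPairing_zProd_cons_eq_pderiv (T : Bonsai m) (l : List (Bonsai m)) {P : BonsaiAlg k m}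
    (hP : P ∈ augIdeal k m ^ (l.length + 1)) :
    envPairing h (zProd h (T :: l)) P = envPairing h (zProd h l) (pderiv T P) := by
  -- The difference of the two derivations has values in the augmentation ideal.
  rw [envPairing_zProd_cons, ← sub_eq_zero, ← map_sub, ← Derivation.sub_apply]
  refine envPairing_zProd_of_mem_augIdeal_pow h l
    (derivation_mem_ideal_pow_of_le _ _ (fun Q _ => ?_) _ hP)
  rw [mem_augIdeal, Derivation.sub_apply, map_sub, counit_cutDer, zMap_single, one_mul, sub_self]

theorem pderiv_forest (T : Bonsai m) (F : Multiset (Bonsai m)) :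
    pderiv T (forest k F) = (F.count T : k) • forest k (F.erase T) := by
  rw [forest_eq_monomial, forest_eq_monomial, pderiv_monomial, smul_monomial, one_mul, smul_eq_mul,
    mul_one, Multiset.toFinsupp_apply]
  by_cases hT : T ∈ F
  · congr 1
    obtain ⟨G, rfl⟩ := Multiset.exists_cons_of_mem hT
    rw [Multiset.erase_cons_head, ← Multiset.singleton_add, map_add, Multiset.toFinsupp_singleton,
      add_tsub_cancel_left]
  · rw [Multiset.count_eq_zero_of_notMem hT]
    simp

/-- For equal numbers of factors, the pairing counts the bijections between the factors and the
trees of the forest that match equal bonsais; characteristic zero keeps this count from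
vanishing. -/
theorem envPairing_zProd_forest_ne_zero_iff [CharZero k] (l : List (Bonsai m))
    (F : Multiset (Bonsai m)) (hl : F.card = l.length) :
    envPairing h (zProd h l) (forest k F) ≠ 0 ↔ (l : Multiset (Bonsai m)) = F := by
  induction l generalizing F with
  | nil =>
    obtain rfl : F = 0 := Multiset.card_eq_zero.mp hl
    simp [zProd, envPairing_one]
  | cons T l ih =>
    rw [List.length_cons] at hl
    rw [envPairing_zProd_cons_eq_pderiv h T l (hl ▸ forest_mem_augIdeal_pow F), pderiv_forest,
      map_smul, smul_eq_mul, mul_ne_zero_iff, Nat.cast_ne_zero, Multiset.count_ne_zero]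
    by_cases hT : T ∈ F
    · obtain ⟨G, rfl⟩ := Multiset.exists_cons_of_mem hT
      rw [Multiset.card_cons, add_left_inj] at hl
      rw [Multiset.erase_cons_head, ih G hl, ← Multiset.cons_coe, Multiset.cons_inj_right]
      simp
    · simp only [hT, false_and, false_iff]
      rintro rfl
      simp at hT

theorem envPairing_toList_forest_triangular [CharZero k] {F G : Multiset (Bonsai m)}
    (hFG : envPairing h (zProd h F.toList) (forest k G) ≠ 0) : F = G ∨ G.card < F.card := by
  rcases lt_trichotomy G.card F.card with h1 | h1 | h1
  · exact Or.inr h1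
  · left
    rw [envPairing_zProd_forest_ne_zero_iff h _ _ (by simpa using h1)] at hFG
    simpa using hFG
  · refine (hFG (envPairing_zProd_of_mem_augIdeal_pow h _ ?_)).elim
    exact Ideal.pow_le_pow_right (by simpa using h1) (forest_mem_augIdeal_pow G)

/-- Permuting the factors of a product of generators changes it by products of fewer
generators. -/
theorem zProd_sub_zProd_mem_of_perm {l l' : List (Bonsai m)} (hl : l.Perm l') :
    zProd h l - zProd h l' ∈
      Submodule.span k (zProd h '' {l₁ | l₁.length < l.length}) := by
  induction hl with
  | nil => simp
  | cons T _ ih =>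
    rw [zProd_cons, zProd_cons, ← mul_sub]
    refine Submodule.span_induction (p := fun u _ => envIncl k m h (Finsupp.single T 1) * u ∈ _)
      ?_ ?_ ?_ ?_ ih
    · rintro _ ⟨l, hl, rfl⟩
      exact Submodule.subset_span ⟨T :: l, by simpa using hl, zProd_cons h T l⟩
    · rw [mul_zero]
      exact Submodule.zero_mem _
    · intro u v _ _ hu hv
      rw [mul_add]
      exact Submodule.add_mem _ hu hv
    · intro a u _ hu
      rw [mul_smul_comm]
      exact Submodule.smul_mem _ _ hu
  -- Two neighbours commute up to their bracket, which is a linear combination of generators.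
  | swap T T' l =>
    have h1 : zProd h (T' :: T :: l) - zProd h (T :: T' :: l) =
        envIncl k m h (bracket k m (Finsupp.single T' 1) (Finsupp.single T 1)) * zProd h l := by
      have h2 : envIncl k m h (bracket k m (Finsupp.single T' 1) (Finsupp.single T 1)) =
          envIncl k m h (Finsupp.single T' 1) * envIncl k m h (Finsupp.single T 1) -
            envIncl k m h (Finsupp.single T 1) * envIncl k m h (Finsupp.single T' 1) :=
        LieHom.map_lie (UniversalEnvelopingAlgebra.ι k)
          (toLieOf h (Finsupp.single T' 1)) (toLieOf h (Finsupp.single T 1))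
      rw [h2, zProd_cons, zProd_cons, zProd_cons, zProd_cons, sub_mul, mul_assoc, mul_assoc]
    rw [h1]
    generalize bracket k m (Finsupp.single T' 1) (Finsupp.single T 1) = x
    induction x using Finsupp.induction_linear with
    | zero => simp
    | add x y hx hy => rw [map_add, add_mul]; exact Submodule.add_mem _ hx hy
    | single S a =>
      rw [← Finsupp.smul_single_one, map_smul, smul_mul_assoc,
        ← zProd_cons]
      exact Submodule.smul_mem _ _ (Submodule.subset_span ⟨S :: l, by simp, rfl⟩)
  | trans h1 _ ih1 ih2 =>
    rw [← sub_add_sub_cancel]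
    rw [← h1.length_eq] at ih2
    exact Submodule.add_mem _ ih1 ih2

/-- The part of the Poincaré-Birkhoff-Witt theorem that does not need a representation of the
enveloping algebra: one product of generators for each forest suffices to span. -/
theorem zProd_mem_span_toList (l : List (Bonsai m)) : zProd h l ∈
    Submodule.span k (Set.range fun F : Multiset (Bonsai m) => zProd h F.toList) := by
  induction hn : l.length using Nat.strong_induction_on generalizing l with
  | _ n ih =>
    subst hn
    have hperm : l.Perm (l : Multiset (Bonsai m)).toList := by
      rw [← Multiset.coe_eq_coe, Multiset.coe_toList]
    rw [← sub_add_cancel (zProd h l) (zProd h (l : Multiset (Bonsai m)).toList)]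
    refine Submodule.add_mem _ (Submodule.span_le.mpr ?_ (zProd_sub_zProd_mem_of_perm h hperm))
      (Submodule.subset_span ⟨(l : Multiset (Bonsai m)), rfl⟩)
    rintro _ ⟨l₁, hl₁, rfl⟩
    exact ih _ hl₁ l₁ rfl

theorem span_zProd_toList :
    Submodule.span k (Set.range fun F : Multiset (Bonsai m) => zProd h F.toList) = ⊤ := by
  have h1 : Submodule.span k (Set.range (zProd h)) = ⊤ := by
    refine Submodule.eq_top_iff'.mpr fun u => ?_
    induction u using env_left_induction with
    | one => exact Submodule.subset_span ⟨[], by simp [zProd]⟩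
    | add u v hu hv => exact Submodule.add_mem _ hu hv
    | smul a u hu => exact Submodule.smul_mem _ _ hu
    | ι_mul x u hu =>
      obtain ⟨x, rfl⟩ := (toLieOf h).surjective x
      change envIncl k m h x * u ∈ _
      induction hu using Submodule.span_induction with
      | mem u hu =>
        obtain ⟨l, rfl⟩ := hu
        induction x using Finsupp.induction_linear with
        | zero => simp
        | add x y hx hy => rw [map_add, add_mul]; exact Submodule.add_mem _ hx hy
        | single S a =>
          rw [← Finsupp.smul_single_one, map_smul, smul_mul_assoc,
            ← zProd_cons]
          exact Submodule.smul_mem _ _ (Submodule.subset_span ⟨S :: l, rfl⟩)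
      | zero => rw [mul_zero]; exact Submodule.zero_mem _
      | add u v _ _ hu hv => rw [mul_add]; exact Submodule.add_mem _ hu hv
      | smul a u _ hu => rw [mul_smul_comm]; exact Submodule.smul_mem _ _ hu
  rw [eq_top_iff, ← h1, Submodule.span_le]
  rintro _ ⟨l, rfl⟩
  exact zProd_mem_span_toList h l

end Forests

/-! ### Pairings with a triangular matrix -/

section Duality

variable {k : Type*} [Field k] {I α : Type*} [LinearOrder α]

/-- A finite triangular matrix has no kernel; `ρ` orders the indices, and distinct indices of the
same rank are not linked by an entry. -/
theorem eq_zero_of_triangular (M : I → I → k) (ρ : I → α)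
    (htri : ∀ i j, M i j ≠ 0 → i = j ∨ ρ j < ρ i) (hdiag : ∀ i, M i i ≠ 0) (s : Finset I)
    (c : I → k) (hc : ∀ j ∈ s, ∑ i ∈ s, c i * M i j = 0) : ∀ i ∈ s, c i = 0 := by
  classical
  by_contra! hne
  obtain ⟨i, hi, hci⟩ := hne
  -- In the column of an index `j` of maximal rank with `c j ≠ 0`, only the diagonal entry counts.
  obtain ⟨j, hj, hmax⟩ := (s.filter fun i => c i ≠ 0).exists_max_image ρ
    ⟨i, Finset.mem_filter.mpr ⟨hi, hci⟩⟩
  obtain ⟨hj, hcj⟩ := Finset.mem_filter.mp hj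
  have h := hc j hj
  rw [Finset.sum_eq_single_of_mem j hj] at h
  · exact mul_ne_zero hcj (hdiag j) h
  · intro i hi hij
    by_contra hne
    have h1 := left_ne_zero_of_mul hne
    rcases htri i j (right_ne_zero_of_mul hne) with h2 | h2
    · exact hij h2
    · exact not_lt_of_ge (hmax i (Finset.mem_filter.mpr ⟨hi, h1⟩)) h2

variable {U H : Type*} [AddCommGroup U] [Module k U] [AddCommGroup H] [Module k H]
  (β : U →ₗ[k] Module.Dual k H) {Z : I → U} {b : I → H} (ρ : I → α)

theorem pairing_injective (hZ : Submodule.span k (Set.range Z) = ⊤)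
    (htri : ∀ i j, β (Z i) (b j) ≠ 0 → i = j ∨ ρ j < ρ i) (hdiag : ∀ i, β (Z i) (b i) ≠ 0) :
    Function.Injective β := by
  rw [injective_iff_map_eq_zero]
  intro u hu
  obtain ⟨c, rfl⟩ := Finsupp.mem_span_range_iff_exists_finsupp.mp (hZ ▸ Submodule.mem_top : u ∈ _)
  have h := eq_zero_of_triangular (fun i j => β (Z i) (b j)) ρ htri hdiag c.support c fun j _ => by
    simpa [Finsupp.sum, LinearMap.sum_apply] using LinearMap.congr_fun hu (b j)
  exact Finset.sum_eq_zero fun i hi => by simp only [h i hi, zero_smul]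

/-- A functional that is supported in finitely many degrees is given by an element of the same
degrees, if the matrix of the pairing is block diagonal with finite triangular blocks. -/
theorem exists_pairing_eq (hb : Submodule.span k (Set.range b) = ⊤) {deg : I → ℕ}
    (hfin : ∀ n, {i | deg i = n}.Finite) (hdeg : ∀ i j, β (Z i) (b j) ≠ 0 → deg i = deg j)
    (htri : ∀ i j, β (Z i) (b j) ≠ 0 → i = j ∨ ρ j < ρ i) (hdiag : ∀ i, β (Z i) (b i) ≠ 0)
    (D : Finset ℕ) (f : Module.Dual k H) (hf : ∀ i, deg i ∉ D → f (b i) = 0) :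
    ∃ u ∈ Submodule.span k (Z '' {i | deg i ∈ D}), β u = f := by
  classical
  have hS : {i | deg i ∈ D}.Finite := by
    refine (D.finite_toSet.biUnion fun n _ => hfin n).subset fun i hi => ?_
    exact Set.mem_biUnion (show deg i ∈ (D : Set ℕ) from hi) rfl
  have := hS.fintype
  let L : ({i | deg i ∈ D} → k) →ₗ[k] ({i | deg i ∈ D} → k) :=
    { toFun := fun c j => ∑ i, c i * β (Z i) (b j)
      map_add' := fun c d => by
        ext j
        simp [add_mul, Finset.sum_add_distrib]
      map_smul' := fun a c => by
        ext j
        simp [mul_assoc, Finset.mul_sum] }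
  have hL : Function.Injective L := by
    rw [injective_iff_map_eq_zero]
    intro c hc
    ext i
    refine eq_zero_of_triangular (fun i j : {i | deg i ∈ D} => β (Z i) (b j)) (fun i => ρ i)
      (fun i j hij => ?_) (fun i => hdiag i) Finset.univ c (fun j _ => congrFun hc j) i
      (Finset.mem_univ i)
    exact (htri i j hij).imp_left Subtype.ext
  obtain ⟨c, hc⟩ := LinearMap.injective_iff_surjective.mp hL fun i => f (b i)
  refine ⟨∑ i, c i • Z i, Submodule.sum_mem _ fun i _ => Submodule.smul_mem _ _
    (Submodule.subset_span ⟨i, i.2, rfl⟩), LinearMap.ext_on_range hb fun j => ?_⟩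
  rw [map_sum, LinearMap.sum_apply]
  simp only [map_smul, LinearMap.smul_apply, smul_eq_mul]
  by_cases hj : deg j ∈ D
  · exact congrFun hc ⟨j, hj⟩
  · rw [hf j hj]
    refine Finset.sum_eq_zero fun i _ => ?_
    by_contra hne
    exact hj (hdeg i j (right_ne_zero_of_mul hne) ▸ i.2)

theorem dualDistrib_map_apply (t : U ⊗[k] U) (P Q : H) :
    TensorProduct.dualDistrib k H H (TensorProduct.map β β t) (P ⊗ₜ Q) =
      TensorProduct.dualDistrib k U U (β.flip P ⊗ₜ β.flip Q) t := by
  induction t with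
  | zero => simp
  | add s t hs ht => simp only [map_add, LinearMap.add_apply, hs, ht]
  | tmul u v => simp

end Duality

/-! ### The antipodes -/

section EnvAntipode

variable {k : Type*} [Field k] {𝔤 : Type*} [LieRing 𝔤] [LieAlgebra k 𝔤]

variable (k 𝔤) in
/-- The coalgebra underlying the enveloping algebra. -/
noncomputable abbrev envCoalgebra : Coalgebra k (UniversalEnvelopingAlgebra k 𝔤) where
  comul := (envComul k 𝔤).toLinearMap
  counit := (envCounit k 𝔤).toLinearMap
  coassoc := by
    have h : (Algebra.TensorProduct.assoc k k k _ _ _).toAlgHom.comp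
        ((Algebra.TensorProduct.map (envComul k 𝔤) (.id k _)).comp (envComul k 𝔤)) =
        (Algebra.TensorProduct.map (.id k _) (envComul k 𝔤)).comp (envComul k 𝔤) := by
      refine env_algHom_ext fun x => ?_
      change (Algebra.TensorProduct.assoc k k k _ _ _) (Algebra.TensorProduct.map (envComul k 𝔤)
        (.id k _) (envComul k 𝔤 (UniversalEnvelopingAlgebra.ι k x))) =
        Algebra.TensorProduct.map (.id k _) (envComul k 𝔤)
          (envComul k 𝔤 (UniversalEnvelopingAlgebra.ι k x))
      simp only [envComul_ι, map_add, Algebra.TensorProduct.map_tmul, map_one, AlgHom.id_apply,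
        Algebra.TensorProduct.one_def, TensorProduct.add_tmul, TensorProduct.tmul_add,
        Algebra.TensorProduct.assoc_tmul, add_assoc]
    exact congrArg AlgHom.toLinearMap h
  rTensor_counit_comp_comul := by
    have h : (Algebra.TensorProduct.map (envCounit k 𝔤) (.id k _)).comp (envComul k 𝔤) =
        Algebra.TensorProduct.includeRight := by
      refine env_algHom_ext fun x => ?_
      change Algebra.TensorProduct.map (envCounit k 𝔤) (.id k _)
        (envComul k 𝔤 (UniversalEnvelopingAlgebra.ι k x)) =
        1 ⊗ₜ UniversalEnvelopingAlgebra.ι k x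
      simp only [envComul_ι, map_add, Algebra.TensorProduct.map_tmul, map_one, AlgHom.id_apply,
        envCounit_ι, TensorProduct.zero_tmul, zero_add]
    exact congrArg AlgHom.toLinearMap h
  lTensor_counit_comp_comul := by
    have h : (Algebra.TensorProduct.map (.id k _) (envCounit k 𝔤)).comp (envComul k 𝔤) =
        Algebra.TensorProduct.includeLeft := by
      refine env_algHom_ext fun x => ?_
      change Algebra.TensorProduct.map (.id k _) (envCounit k 𝔤)
        (envComul k 𝔤 (UniversalEnvelopingAlgebra.ι k x)) =
        UniversalEnvelopingAlgebra.ι k x ⊗ₜ 1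
      simp only [envComul_ι, map_add, Algebra.TensorProduct.map_tmul, map_one, AlgHom.id_apply,
        envCounit_ι, TensorProduct.tmul_zero, add_zero]
    exact congrArg AlgHom.toLinearMap h

theorem mul_map_id_antipode_envComul (u : UniversalEnvelopingAlgebra k 𝔤) :
    LinearMap.mul' k _ (TensorProduct.map LinearMap.id (envHopf k 𝔤).antipode (envComul k 𝔤 u)) =
      algebraMap k _ (envCounit k 𝔤 u) := by
  induction u using env_left_induction with
  | one =>
    rw [map_one, Algebra.TensorProduct.one_def, TensorProduct.map_tmul]
    simp [envHopf]
  | add u v hu hv => simp only [map_add, hu, hv]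
  | smul a u hu =>
    rw [map_smul, map_smul, map_smul, map_smul, hu, smul_eq_mul, map_mul, Algebra.smul_def]
  | ι_mul x u hu =>
    have key : ∀ t, LinearMap.mul' k _ (TensorProduct.map LinearMap.id (envHopf k 𝔤).antipode
        (envComul k 𝔤 (UniversalEnvelopingAlgebra.ι k x) * t)) =
        UniversalEnvelopingAlgebra.ι k x * LinearMap.mul' k _
          (TensorProduct.map LinearMap.id (envHopf k 𝔤).antipode t) -
        LinearMap.mul' k _ (TensorProduct.map LinearMap.id (envHopf k 𝔤).antipode t) *
          UniversalEnvelopingAlgebra.ι k x := by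
      intro t
      rw [envComul_ι]
      induction t with
      | zero => simp
      | add s t hs ht =>
        simp only [mul_add, map_add] at hs ht ⊢
        rw [hs, ht]
        noncomm_ring
      | tmul a b =>
        simp only [add_mul, Algebra.TensorProduct.tmul_mul_tmul, one_mul, map_add,
          TensorProduct.map_tmul, LinearMap.id_apply, LinearMap.mul'_apply,
          envHopf_antipode_ι_mul]
        noncomm_ring
    rw [map_mul, key, hu, map_mul, envCounit_ι, zero_mul, map_zero, Algebra.commutes, sub_self]

/-- The antipode of the enveloping algebra is the only left inverse of the identity for the
convolution product. -/
theorem eq_envHopf_antipode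
    (S : UniversalEnvelopingAlgebra k 𝔤 →ₗ[k] UniversalEnvelopingAlgebra k 𝔤)
    (hS : ∀ u, LinearMap.mul' k _ (TensorProduct.map S LinearMap.id (envComul k 𝔤 u)) =
      algebraMap k _ (envCounit k 𝔤 u)) : S = (envHopf k 𝔤).antipode := by
  let := envCoalgebra k 𝔤
  have h1 : WithConv.toConv S * WithConv.toConv LinearMap.id = 1 := by
    ext u
    exact hS u
  have h2 : WithConv.toConv LinearMap.id * WithConv.toConv (envHopf k 𝔤).antipode = 1 := by
    ext u
    exact mul_map_id_antipode_envComul u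
  exact WithConv.toConv_injective (left_inv_eq_right_inv h1 h2)

end EnvAntipode

section Antipode

open MvPolynomial Bonsai

variable {k : Type*} [Field k] {m : ℕ}

theorem antipodeGen_eq (T : Bonsai m) : antipodeGen k T = -X T - ∑ c ∈ T.simpleCuts.erase ∅,
    (∏ v ∈ c, antipodeGen k (T.branch v)) * X (T.trunk c) := by
  rw [antipodeGen, ← Finset.sum_attach (T.simpleCuts.erase ∅)]
  congr 1
  refine Finset.sum_congr rfl fun c _ => ?_
  rw [← Finset.prod_attach c.1]

/-- The recursive definition of the antipode says that it is a left inverse of the identity for the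
convolution product. -/
theorem mul_map_antipode_comul (P : BonsaiAlg k m) :
    LinearMap.mul' k _ (TensorProduct.map (antipode k m).toLinearMap LinearMap.id
      (comul k m P)) = algebraMap k _ (counit k m P) := by
  have h : ((Algebra.TensorProduct.lmul' k).comp
      (Algebra.TensorProduct.map (antipode k m) (.id k _))).comp (comul k m) =
      (Algebra.ofId k _).comp (counit k m) := by
    refine algHom_ext fun T => ?_
    rw [AlgHom.comp_apply, AlgHom.comp_apply, comul_X, ← Finset.add_sum_erase _ _
      (empty_mem_simpleCuts (T := T))]
    simp only [map_add, map_sum, Algebra.TensorProduct.map_tmul, map_prod, AlgHom.id_apply,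
      Algebra.TensorProduct.lmul'_apply_tmul, Finset.prod_empty, map_one, one_mul, mul_one,
      trunk_empty, AlgHom.comp_apply, counit_X, map_zero]
    have hX : ∀ T : Bonsai m, antipode k m (X T) = antipodeGen k T := fun T => aeval_X _ _
    simp only [hX]
    rw [antipodeGen_eq T]
    ring
  exact AlgHom.congr_fun h P

theorem sum_deg_branch_add_deg_trunk {T : Bonsai m} {c : Finset (List (Fin m))}
    (hc : c ∈ T.simpleCuts) : ∑ v ∈ c, (T.branch v).deg + (T.trunk c).deg = T.deg := by
  induction c using Finset.induction_on generalizing T with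
  | empty => rw [Finset.sum_empty, trunk_empty, zero_add]
  | insert e c he ih =>
    have hmem := Finset.mem_insert_self e c
    have heT := mem_edges_of_mem_simpleCuts hc hmem
    obtain ⟨h1, h2⟩ := erase_mem_simpleCuts hc hmem
    rw [Finset.erase_insert he] at h1 h2
    have h3 := ih h1
    rw [trunk_trunk, Finset.singleton_union] at h3
    rw [Finset.sum_insert he, ← deg_trunk_add_deg_branch heT, ← h3, add_assoc]
    congr 2
    refine Finset.sum_congr rfl fun v hv => ?_
    have hvT := (mem_edges_trunk_singleton (mem_edges.mp heT).1).mp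
      (mem_edges_of_mem_simpleCuts h1 hv)
    rw [branch_trunk_of_not_prefix (mem_edges.mp hvT.1).2 (mem_edges.mp heT).1 hvT.2 (h2 v hv)]

theorem antipodeGen_mem_bonsaiGrading (T : Bonsai m) :
    antipodeGen k T ∈ bonsaiGrading k m T.deg := by
  induction hn : T.deg using Nat.strong_induction_on generalizing T with
  | _ n ih =>
    subst hn
    rw [antipodeGen_eq]
    have hX : ∀ T : Bonsai m, (X T : BonsaiAlg k m) ∈ bonsaiGrading k m T.deg :=
      fun T => isWeightedHomogeneous_X _ _ _
    refine Submodule.sub_mem _ (Submodule.neg_mem _ (hX T)) (Submodule.sum_mem _ fun c hc => ?_)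
    have hc' := Finset.mem_of_mem_erase hc
    rw [← sum_deg_branch_add_deg_trunk hc']
    refine IsWeightedHomogeneous.mul (IsWeightedHomogeneous.prod _ _ _ fun v hv => ?_) (hX _)
    exact ih _ (deg_branch_lt (mem_edges_of_mem_simpleCuts hc' hv)) _ rfl

theorem antipode_forest_mem_bonsaiGrading (F : Multiset (Bonsai m)) :
    antipode k m (forest k F) ∈ bonsaiGrading k m (forestDeg F) := by
  induction F using Multiset.induction_on with
  | empty =>
    rw [forest_zero, map_one]
    exact isWeightedHomogeneous_one _ _
  | cons T F ih =>
    rw [forest_cons, map_mul, forestDeg, Multiset.map_cons, Multiset.sum_cons]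
    refine IsWeightedHomogeneous.mul ?_ ih
    rw [antipode, aeval_X]
    exact antipodeGen_mem_bonsaiGrading T

end Antipode

/-! ### The graded duality -/

section GradedDuality

open MvPolynomial Bonsai

variable {k : Type*} [Field k] {m : ℕ} (h : IsLieBracket (bracket k m))

/-- A forest of degree `n` has at most `n` trees, each of degree at most `n`. -/
theorem finite_forestDeg_eq (n : ℕ) : {F : Multiset (Bonsai m) | forestDeg F = n}.Finite := by
  refine (Set.finite_Iic (n • (finite_deg_le m n).toFinset.val)).subset fun F hF => ?_
  rw [Set.mem_Iic, Multiset.le_iff_count]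
  intro T
  have hcard : ∀ F : Multiset (Bonsai m), F.card ≤ forestDeg F := by
    intro F
    have := Multiset.card_nsmul_le_sum (s := F.map deg) (a := 1) (by
      intro x hx
      obtain ⟨T, -, rfl⟩ := Multiset.mem_map.mp hx
      exact T.deg_pos)
    simpa [forestDeg] using this
  by_cases hT : T ∈ F
  · have h1 : T.deg ≤ n := by
      rw [← show forestDeg F = n from hF]
      exact Multiset.le_sum_of_mem (Multiset.mem_map_of_mem deg hT)
    rw [Multiset.count_nsmul, Multiset.count_eq_one_of_mem (Finset.nodup _) (by simpa using h1),
      mul_one]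
    exact (Multiset.count_le_card T F).trans ((hcard F).trans hF.le)
  · rw [Multiset.count_eq_zero_of_notMem hT]
    exact Nat.zero_le _

theorem sum_deg_toList (F : Multiset (Bonsai m)) : (F.toList.map deg).sum = forestDeg F := by
  rw [forestDeg, ← Multiset.sum_coe, ← Multiset.map_coe, Multiset.coe_toList]

theorem zProd_toList_mem_envGrading (F : Multiset (Bonsai m)) :
    zProd h F.toList ∈ envGrading k m h (forestDeg F) :=
  sum_deg_toList F ▸ zProd_mem_envGrading h F.toList

theorem envPairing_eq_zero_of_ne {i j : ℕ} (hij : i ≠ j) {u : EnvL1 k m h} {P : BonsaiAlg k m}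
    (hu : u ∈ envGrading k m h i) (hP : P ∈ bonsaiGrading k m j) : envPairing h u P = 0 := by
  rw [bonsaiGrading_eq_span] at hP
  induction hu using Submodule.span_induction with
  | mem u hu =>
    obtain ⟨l, rfl, rfl⟩ := hu
    induction hP using Submodule.span_induction with
    | mem P hP =>
      obtain ⟨F, rfl, rfl⟩ := hP
      exact envPairing_zProd_forest_of_deg_ne h l F hij
    | zero => rw [map_zero]
    | add P Q _ _ hP hQ => rw [map_add, hP, hQ, add_zero]
    | smul a P _ hP => rw [map_smul, hP, smul_zero]
  | zero => rw [map_zero, LinearMap.zero_apply]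
  | add u v _ _ hu hv => rw [map_add, LinearMap.add_apply, hu, hv, add_zero]
  | smul a u _ hu => rw [map_smul, LinearMap.smul_apply, hu, smul_zero]

theorem envPairing_mem_gradedDual (u : EnvL1 k m h) :
    envPairing h u ∈ gradedDual (bonsaiGrading k m) := by
  have hu : u ∈ Submodule.span k (Set.range fun F : Multiset (Bonsai m) => zProd h F.toList) :=
    span_zProd_toList h ▸ Submodule.mem_top
  induction hu using Submodule.span_induction with
  | mem u hu =>
    obtain ⟨F, rfl⟩ := hu
    exact ⟨forestDeg F + 1, fun n hn P hP =>
      envPairing_eq_zero_of_ne h (by omega) (zProd_toList_mem_envGrading h F) hP⟩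
  | zero => rw [map_zero]; exact Submodule.zero_mem _
  | add u v _ _ hu hv => rw [map_add]; exact Submodule.add_mem _ hu hv
  | smul a u _ hu => rw [map_smul]; exact Submodule.smul_mem _ _ hu

theorem envPairing_flip_mem_gradedDual (P : BonsaiAlg k m) :
    (envPairing h).flip P ∈ gradedDual (envGrading k m h) := by
  have hP : P ∈ Submodule.span k (Set.range (forest k (m := m))) :=
    span_forest k m ▸ Submodule.mem_top
  induction hP using Submodule.span_induction with
  | mem P hP =>
    obtain ⟨F, rfl⟩ := hP
    exact ⟨forestDeg F + 1, fun n hn u hu =>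
      envPairing_eq_zero_of_ne h (by omega) hu (forest_mem_bonsaiGrading F)⟩
  | zero => rw [map_zero]; exact Submodule.zero_mem _
  | add P Q _ _ hP hQ => rw [map_add]; exact Submodule.add_mem _ hP hQ
  | smul a P _ hP => rw [map_smul]; exact Submodule.smul_mem _ _ hP

theorem forestDeg_eq_of_envPairing_ne_zero (F G : Multiset (Bonsai m))
    (hFG : envPairing h (zProd h F.toList) (forest k G) ≠ 0) : forestDeg F = forestDeg G := by
  by_contra hne
  exact hFG (envPairing_eq_zero_of_ne h hne (zProd_toList_mem_envGrading h F)
    (forest_mem_bonsaiGrading G))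

theorem envPairing_comp_antipode_mem_gradedDual (u : EnvL1 k m h) :
    envPairing h u ∘ₗ (antipode k m).toLinearMap ∈ gradedDual (bonsaiGrading k m) := by
  obtain ⟨N, hN⟩ := envPairing_mem_gradedDual h u
  refine ⟨N, fun n hn P hP => ?_⟩
  rw [bonsaiGrading_eq_span] at hP
  induction hP using Submodule.span_induction with
  | mem P hP =>
    obtain ⟨F, rfl, rfl⟩ := hP
    exact hN _ hn _ (antipode_forest_mem_bonsaiGrading F)
  | zero => rw [map_zero]
  | add P Q _ _ hP hQ => rw [map_add, hP, hQ, add_zero]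
  | smul a P _ hP => rw [map_smul, hP, smul_zero]

theorem envPairing_mul' (t : EnvL1 k m h ⊗[k] EnvL1 k m h) (P : BonsaiAlg k m) :
    envPairing h (LinearMap.mul' k _ t) P =
      TensorProduct.dualDistrib k _ _ (TensorProduct.map (envPairing h) (envPairing h) t)
        (comul k m P) := by
  induction t with
  | zero => simp
  | add s t hs ht => simp only [map_add, LinearMap.add_apply, hs, ht]
  | tmul u v =>
    rw [LinearMap.mul'_apply, envPairing_mul, TensorProduct.map_tmul]
    rfl

theorem dualDistrib_envPairing_envComul_eq (u : EnvL1 k m h)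
    (w : BonsaiAlg k m ⊗[k] BonsaiAlg k m) :
    TensorProduct.dualDistrib k _ _ (TensorProduct.map (envPairing h) (envPairing h)
      (envComul k _ u)) w = envPairing h u (LinearMap.mul' k _ w) := by
  induction w with
  | zero => simp
  | add s t hs ht => simp only [map_add, hs, ht]
  | tmul P Q => rw [dualDistrib_envPairing_envComul, LinearMap.mul'_apply]

section CharZero

variable [CharZero k]

theorem envPairing_toList_forest_self_ne_zero (F : Multiset (Bonsai m)) :
    envPairing h (zProd h F.toList) (forest k F) ≠ 0 := by
  rw [envPairing_zProd_forest_ne_zero_iff h _ _ (by simp), Multiset.coe_toList]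

theorem envPairing_injective : Function.Injective (envPairing h) :=
  pairing_injective (envPairing h) Multiset.card (span_zProd_toList h)
    (fun _ _ => envPairing_toList_forest_triangular h) (envPairing_toList_forest_self_ne_zero h)

/-- Transposing the matrix of the pairing reverses the order of the ranks. -/
theorem envPairing_flip_injective : Function.Injective (envPairing h).flip :=
  pairing_injective (envPairing h).flip (fun F => OrderDual.toDual (Multiset.card F))
    (span_forest k m) (Z := forest k) (b := fun F : Multiset (Bonsai m) => zProd h F.toList)
    (fun _ _ hFG => (envPairing_toList_forest_triangular h hFG).imp_left Eq.symm)
    (envPairing_toList_forest_self_ne_zero h)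

theorem exists_envPairing_eq (D : Finset ℕ) (f : Module.Dual k (BonsaiAlg k m))
    (hf : ∀ F, forestDeg F ∉ D → f (forest k F) = 0) :
    ∃ u ∈ Submodule.span k ((fun F : Multiset (Bonsai m) => zProd h F.toList) ''
      {F | forestDeg F ∈ D}), envPairing h u = f :=
  exists_pairing_eq (envPairing h) Multiset.card (span_forest k m) finite_forestDeg_eq
    (forestDeg_eq_of_envPairing_ne_zero h) (fun _ _ => envPairing_toList_forest_triangular h)
    (envPairing_toList_forest_self_ne_zero h) D f hf

theorem exists_envPairing_flip_eq (D : Finset ℕ) (f : Module.Dual k (EnvL1 k m h))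
    (hf : ∀ F : Multiset (Bonsai m), forestDeg F ∉ D → f (zProd h F.toList) = 0) :
    ∃ P ∈ Submodule.span k (forest k '' {F : Multiset (Bonsai m) | forestDeg F ∈ D}),
      (envPairing h).flip P = f :=
  exists_pairing_eq (envPairing h).flip (fun F => OrderDual.toDual (Multiset.card F))
    (span_zProd_toList h) finite_forestDeg_eq
    (fun F G hFG => (forestDeg_eq_of_envPairing_ne_zero h G F hFG).symm)
    (fun _ _ hFG => (envPairing_toList_forest_triangular h hFG).imp_left Eq.symm)
    (envPairing_toList_forest_self_ne_zero h) D f hf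

theorem mem_envGrading_iff (n : ℕ) (u : EnvL1 k m h) : u ∈ envGrading k m h n ↔
    ∀ j, j ≠ n → ∀ P ∈ bonsaiGrading k m j, envPairing h u P = 0 := by
  refine ⟨fun hu j hj P hP => envPairing_eq_zero_of_ne h hj.symm hu hP, fun hu => ?_⟩
  obtain ⟨v, hv, hvu⟩ := exists_envPairing_eq h {n} (envPairing h u) fun F hF =>
    hu _ (by simpa using hF) _ (forest_mem_bonsaiGrading F)
  obtain rfl := envPairing_injective h hvu
  refine Submodule.span_le.mpr ?_ hv
  rintro _ ⟨F, hF, rfl⟩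
  exact Finset.mem_singleton.mp hF ▸ zProd_toList_mem_envGrading h F

theorem mem_bonsaiGrading_iff (n : ℕ) (P : BonsaiAlg k m) : P ∈ bonsaiGrading k m n ↔
    ∀ j, j ≠ n → ∀ u ∈ envGrading k m h j, envPairing h u P = 0 := by
  refine ⟨fun hP j hj u hu => envPairing_eq_zero_of_ne h hj hu hP, fun hP => ?_⟩
  obtain ⟨Q, hQ, hQP⟩ := exists_envPairing_flip_eq h {n} ((envPairing h).flip P) fun F hF =>
    hP _ (by simpa using hF) _ (zProd_toList_mem_envGrading h F)
  obtain rfl := envPairing_flip_injective h hQP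
  refine Submodule.span_le.mpr ?_ hQ
  rintro _ ⟨F, hF, rfl⟩
  exact Finset.mem_singleton.mp hF ▸ forest_mem_bonsaiGrading F

/-- The isomorphism of `U(L¹)` with the graded dual of the bonsai algebra. -/
noncomputable def envEquiv : EnvL1 k m h ≃ₗ[k] gradedDual (bonsaiGrading k m) :=
  LinearEquiv.ofBijective ((envPairing h).codRestrict _ (envPairing_mem_gradedDual h)) <| by
    refine ⟨fun u v huv => envPairing_injective h (congrArg Subtype.val huv), ?_⟩
    rintro ⟨f, N, hN⟩
    obtain ⟨u, -, hu⟩ := exists_envPairing_eq h (Finset.range N) f fun F hF =>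
      hN _ (by simpa using hF) _ (forest_mem_bonsaiGrading F)
    exact ⟨u, Subtype.ext hu⟩

/-- The isomorphism of the bonsai algebra with the graded dual of `U(L¹)`. -/
noncomputable def bonsaiEquiv : BonsaiAlg k m ≃ₗ[k] gradedDual (envGrading k m h) :=
  LinearEquiv.ofBijective
    ((envPairing h).flip.codRestrict _ (envPairing_flip_mem_gradedDual h)) <| by
    refine ⟨fun P Q hPQ => envPairing_flip_injective h (congrArg Subtype.val hPQ), ?_⟩
    rintro ⟨f, N, hN⟩
    obtain ⟨P, -, hP⟩ := exists_envPairing_flip_eq h (Finset.range N) f fun F hF =>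
      hN _ (by simpa using hF) _ (zProd_toList_mem_envGrading h F)
    exact ⟨P, Subtype.ext hP⟩

theorem coe_envEquiv (u : EnvL1 k m h) :
    (envEquiv h u : Module.Dual k (BonsaiAlg k m)) = envPairing h u := rfl

theorem coe_bonsaiEquiv (P : BonsaiAlg k m) :
    (bonsaiEquiv h P : Module.Dual k (EnvL1 k m h)) = (envPairing h).flip P := rfl

/-- The transpose of the antipode of the bonsai algebra, transported to `U(L¹)`. -/
noncomputable def antipodeTranspose : EnvL1 k m h →ₗ[k] EnvL1 k m h :=
  (envEquiv h).symm.toLinearMap ∘ₗ LinearMap.codRestrict _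
    (LinearMap.lcomp k k (antipode k m).toLinearMap ∘ₗ envPairing h)
    (envPairing_comp_antipode_mem_gradedDual h)

theorem envPairing_antipodeTranspose (u : EnvL1 k m h) :
    envPairing h (antipodeTranspose h u) = envPairing h u ∘ₗ (antipode k m).toLinearMap := by
  rw [← coe_envEquiv, antipodeTranspose, LinearMap.comp_apply, LinearEquiv.coe_coe,
    LinearEquiv.apply_symm_apply]
  rfl

theorem dualDistrib_map_antipodeTranspose (t : EnvL1 k m h ⊗[k] EnvL1 k m h)
    (w : BonsaiAlg k m ⊗[k] BonsaiAlg k m) :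
    TensorProduct.dualDistrib k _ _ (TensorProduct.map (envPairing h) (envPairing h)
      (TensorProduct.map (antipodeTranspose h) LinearMap.id t)) w =
    TensorProduct.dualDistrib k _ _ (TensorProduct.map (envPairing h) (envPairing h) t)
      (TensorProduct.map (antipode k m).toLinearMap LinearMap.id w) := by
  induction t with
  | zero => simp
  | add s t hs ht => simp only [map_add, LinearMap.add_apply, hs, ht]
  | tmul u v =>
    induction w with
    | zero => simp
    | add s t hs ht => simp only [map_add, hs, ht]
    | tmul P Q => simp [envPairing_antipodeTranspose]

/-- The antipodes are transposes of each other: both are inverse to the identity of `U(L¹)` for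
the convolution product. -/
theorem antipodeTranspose_eq : antipodeTranspose h = (envHopf k _).antipode := by
  refine eq_envHopf_antipode _ fun u => envPairing_injective h (LinearMap.ext fun P => ?_)
  rw [envPairing_mul', dualDistrib_map_antipodeTranspose, dualDistrib_envPairing_envComul_eq,
    mul_map_antipode_comul, Algebra.algebraMap_eq_smul_one, Algebra.algebraMap_eq_smul_one,
    map_smul, map_smul, envPairing_apply_one, LinearMap.smul_apply, envPairing_one, smul_eq_mul,
    smul_eq_mul, mul_comm]
  rfl

theorem envPairing_antipode (u : EnvL1 k m h) : envPairing h ((envHopf k _).antipode u) =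
    envPairing h u ∘ₗ (antipode k m).toLinearMap := by
  rw [← antipodeTranspose_eq, envPairing_antipodeTranspose]

theorem isGradedHopfIso_envEquiv : IsGradedHopfIso (envGrading k m h) (bonsaiGrading k m)
    (envHopf k (LieOf (bracket k m) h)) (bonsaiHopf k m) (envEquiv h) where
  map_one := envPairing_one h
  map_mul := envPairing_mul h
  map_comul u := TensorProduct.ext' (dualDistrib_envPairing_envComul h u)
  map_counit := envPairing_apply_one h
  map_antipode := envPairing_antipode h
  map_grading := mem_envGrading_iff h

theorem isGradedHopfIso_bonsaiEquiv : IsGradedHopfIso (bonsaiGrading k m) (envGrading k m h)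
    (bonsaiHopf k m) (envHopf k (LieOf (bracket k m) h)) (bonsaiEquiv h) where
  map_one := LinearMap.ext (envPairing_apply_one h)
  map_mul P Q := LinearMap.ext fun u => by
    rw [coe_bonsaiEquiv, LinearMap.flip_apply, ← dualDistrib_envPairing_envComul,
      dualDistrib_map_apply]
    rfl
  map_comul P := TensorProduct.ext' fun u v => by
    refine (dualDistrib_map_apply (envPairing h).flip (comul k m P) u v).trans ?_
    exact (LinearMap.congr_fun (envPairing_mul h u v) P).symm
  map_counit P := LinearMap.congr_fun (envPairing_one h) P
  map_antipode P := LinearMap.ext fun u => (LinearMap.congr_fun (envPairing_antipode h u) P).symm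
  map_grading := mem_bonsaiGrading_iff h

end CharZero

/-! ### Primitive elements -/

theorem isDualPrimitive_iff (f : Module.Dual k (BonsaiAlg k m)) :
    IsDualPrimitive (bonsaiHopf k m) f ↔
      ∀ P Q, f (P * Q) = f P * counit k m Q + counit k m P * f Q := by
  have key : ∀ P Q, TensorProduct.dualDistrib k _ _ (f ⊗ₜ[k] (bonsaiHopf k m).counit +
      (bonsaiHopf k m).counit ⊗ₜ[k] f) (P ⊗ₜ Q) = f P * counit k m Q + counit k m P * f Q := by
    intro P Q
    rw [map_add]
    rfl
  constructor
  · intro hf P Q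
    rw [← key]
    exact (LinearMap.congr_fun hf (P ⊗ₜ Q)).symm
  · intro hf
    refine TensorProduct.ext' fun P Q => ?_
    rw [key, ← hf]
    rfl

theorem mem_range_zMap_iff (f : Module.Dual k (BonsaiAlg k m)) :
    f ∈ LinearMap.range (zMap k m) ↔
      f ∈ gradedDual (bonsaiGrading k m) ∧ IsDualPrimitive (bonsaiHopf k m) f := by
  rw [isDualPrimitive_iff]
  constructor
  · rintro ⟨x, rfl⟩
    refine ⟨?_, zMap_mul x⟩
    rw [← envPairing_envIncl (isLieBracket_bracket k)]
    exact envPairing_mem_gradedDual _ _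
  · rintro ⟨⟨N, hN⟩, hf⟩
    have hfin : (Function.support fun T : Bonsai m => f (X T)).Finite := by
      refine (finite_deg_le m N).subset fun T hT => ?_
      by_contra hlt
      exact hT (hN T.deg (not_le.mp hlt).le _ (isWeightedHomogeneous_X _ _ _))
    refine ⟨Finsupp.ofSupportFinite _ hfin, eq_of_counit_derivation (zMap_mul _) hf fun T => ?_⟩
    rw [zMap_X, Finsupp.ofSupportFinite_coe]

end GradedDuality

end BonsaiHopf

theorem mainTheorem3 (k : Type*) [Field k] (m : ℕ) :
    -- the associator counts two-element cuts
    (∀ T₁ T₂ T₃ T : BonsaiHopf.Bonsai m,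
      BonsaiHopf.assoc k m (Finsupp.single T₁ 1) (Finsupp.single T₂ 1) (Finsupp.single T₃ 1) T =
        (BonsaiHopf.Bonsai.cutCount₂ T₁ T₂ T₃ T : k)) ∧
    -- the product is pre-Lie
    (∀ x y z : BonsaiHopf.L1 k m, BonsaiHopf.assoc k m x y z = BonsaiHopf.assoc k m y x z) ∧
    -- the bracket makes `L¹` a Lie algebra
    ∃ h : BonsaiHopf.IsLieBracket (BonsaiHopf.bracket k m),
      -- `L¹` is the Lie algebra of the primitive elements of the dual Hopf algebra of `H_{b,m}`
      Function.Injective (BonsaiHopf.zMap k m) ∧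
      (∀ f : Module.Dual k (BonsaiHopf.BonsaiAlg k m), f ∈ LinearMap.range (BonsaiHopf.zMap k m) ↔
        f ∈ BonsaiHopf.gradedDual (BonsaiHopf.bonsaiGrading k m) ∧
          BonsaiHopf.IsDualPrimitive (BonsaiHopf.bonsaiHopf k m) f) ∧
      (∀ x y : BonsaiHopf.L1 k m, BonsaiHopf.zMap k m (BonsaiHopf.bracket k m x y) =
        BonsaiHopf.dualMul (BonsaiHopf.bonsaiHopf k m)
            (BonsaiHopf.zMap k m x) (BonsaiHopf.zMap k m y) -
          BonsaiHopf.dualMul (BonsaiHopf.bonsaiHopf k m)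
            (BonsaiHopf.zMap k m y) (BonsaiHopf.zMap k m x)) ∧
      -- in characteristic zero, `U(L¹)` is the graded dual of `H_{b,m}`, and `H_{b,m}` is the
      -- graded dual of `U(L¹)`, by one and the same pairing, which extends `⟨Z_T, P⟩`
      (CharZero k →
        ∃ (Φ : BonsaiHopf.EnvL1 k m h ≃ₗ[k] BonsaiHopf.gradedDual (BonsaiHopf.bonsaiGrading k m))
          (Ψ : BonsaiHopf.BonsaiAlg k m ≃ₗ[k]
            BonsaiHopf.gradedDual (BonsaiHopf.envGrading k m h)),
          BonsaiHopf.IsGradedHopfIso (BonsaiHopf.envGrading k m h) (BonsaiHopf.bonsaiGrading k m)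
            (BonsaiHopf.envHopf k (BonsaiHopf.LieOf (BonsaiHopf.bracket k m) h))
            (BonsaiHopf.bonsaiHopf k m) Φ ∧
          BonsaiHopf.IsGradedHopfIso (BonsaiHopf.bonsaiGrading k m) (BonsaiHopf.envGrading k m h)
            (BonsaiHopf.bonsaiHopf k m)
            (BonsaiHopf.envHopf k (BonsaiHopf.LieOf (BonsaiHopf.bracket k m) h)) Ψ ∧
          (∀ x : BonsaiHopf.L1 k m,
            (Φ (BonsaiHopf.envIncl k m h x) : Module.Dual k (BonsaiHopf.BonsaiAlg k m)) =
              BonsaiHopf.zMap k m x) ∧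
          (∀ (u : BonsaiHopf.EnvL1 k m h) (P : BonsaiHopf.BonsaiAlg k m),
            (Φ u : Module.Dual k (BonsaiHopf.BonsaiAlg k m)) P =
              (Ψ P : Module.Dual k (BonsaiHopf.EnvL1 k m h)) u)) := by
  refine ⟨BonsaiHopf.assoc_single_apply k, BonsaiHopf.assoc_comm k,
    BonsaiHopf.isLieBracket_bracket k, BonsaiHopf.zMap_injective, BonsaiHopf.mem_range_zMap_iff,
    BonsaiHopf.zMap_bracket, fun _ => ?_⟩
  exact ⟨BonsaiHopf.envEquiv _, BonsaiHopf.bonsaiEquiv _, BonsaiHopf.isGradedHopfIso_envEquiv _,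
    BonsaiHopf.isGradedHopfIso_bonsaiEquiv _, BonsaiHopf.envPairing_envIncl _, fun _ _ => rfl⟩
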